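/- Let $\mathcal{O}_2$ be the Cuntz algebra, i.e. the universal unital $C^*$-algebra generated by isometries $S_1,S_2$ with $S_1S_1^*+S_2S_2^*=1$, and let $\mathcal{Q}_2$ be the $2$-adic ring $C^*$-algebra, i.e. the universal unital $C^*$-algebra generated by a unitary $U$ and an isometry $S_2$ with $S_2U=U^2S_2$ and $S_2S_2^*+US_2S_2^*U^*=1$. Regard $\mathcal{O}_2$ as a subalgebra of $\mathcal{Q}_2$ through the embedding $S_1\mapsto US_2$, $S_2\mapsto S_2$, and write $\rho\upharpoonright_{\mathcal{O}_2}$ for the restriction of a representation $\rho$ of $\mathcal{Q}_2$. Representations are unital $*$-representations on complex Hilbert spaces. The canonical representation $\rho_c$ of $\mathcal{Q}_2$ acts on $\ell^2(\mathbb{Z})$ by $\rho_c(U)e_k=e_{k+1}$, $\rho_c(S_2)e_k=e_{2k}$. A representation $\rho$ of $\mathcal{Q}_2$ on $H$ is permutative if there are an orthonormal basis $(e_n)_{n\in\mathbb{N}}$ of $H$, an injection $\sigma_2$ and a bijection $\tau$ of $\mathbb{N}$ with $\rho(S_2)e_n=e_{\sigma_2(n)}$ and $\rho(U)e_n=e_{\tau(n)}$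 for all $n$. A representation $\pi$ of $\mathcal{O}_2$ is permutative if there are an orthonormal basis $(e_n)_{n\in\mathbb{N}}$ and injections $\sigma_1,\sigma_2$ of $\mathbb{N}$ whose ranges partition $\mathbb{N}$ with $\pi(S_i)e_n=e_{\sigma_i(n)}$. Its coding map then sends $n$ to the unique sequence $(i_1,i_2,\ldots)\in\{1,2\}^{\mathbb{N}}$ such that $n$ is in the range of $\sigma_{i_1}\circ\cdots\circ\sigma_{i_k}$ for every $k$. A permutative $\pi$ is multiplicity-free in the sense of Bratteli--Jorgensen if the coding map is injective (for every orthonormal basis in which $\pi$ is permutative). For a non-empty finite or an infinite multi-index $I$ in the alphabet $\{1,2\}$, a permutative representation $\pi$ of $\mathcal{O}_2$ is of type $P(I)$ if some vector $\Omega$ of a basis as above is cyclic and satisfies the following. If $I=(i_1,\ldots,i_k)$: $\pi(S_{i_1}\cdots S_{i_k})\Omega=\Omega$ and the vectors $\Omega,\ \pi(S_{i_1})\Omega,\ \ldots,\ \pi(S_{i_1}\cdots S_{i_{k-1}})\Omega$ are orthonormal. If $I=(i_1,i_2,\ldots)$ is infinite: the vectors $\Omega,\ \pi(S_{i_1}^*)\Omega,\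 \pi(S_{i_2}^*S_{i_1}^*)\Omega,\ \ldots$ are orthonormal. **Theorem.** (a) If $\rho$ is an irreducible permutative representation of $\mathcal{Q}_2$, then $\rho\upharpoonright_{\mathcal{O}_2}$ is unitarily equivalent either to $\rho_c\upharpoonright_{\mathcal{O}_2}$ or to an irreducible representation of type $P(I)$ for some $I$. Moreover $\rho\upharpoonright_{\mathcal{O}_2}$ is multiplicity-free in the sense of Bratteli--Jorgensen. (b) The irreducible permutative representations of $\mathcal{Q}_2$ are thereby classified: 1. $\rho_c$ is permutative and irreducible, and $\rho_c\upharpoonright_{\mathcal{O}_2}$ is not irreducible. 2. Every irreducible representation $\pi$ of $\mathcal{O}_2$ of type $P(I)$ with $I\neq(1)$ and $I\neq(2)$ is the restriction of exactly one representation of $\mathcal{Q}_2$ on the same space, and this extension is permutative and irreducible. 3. A representation of $\mathcal{O}_2$ of type $P(1)$ or $P(2)$ is not the restriction of any representation of $\mathcal{Q}_2$. 4. Two irreducible permutative representations of $\mathcal{Q}_2$ are unitarily equivalent if and only if their restrictions to $\mathcal{O}_2$ are. -/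

import Mathlib

open scoped ENNReal InnerProductSpace

noncomputable section

namespace TwoAdic

universe u v

/-! ### The universal unital C⋆-algebra on two contractive generators subject to a relation

For a relation `P x y` between two elements of a C⋆-algebra, the universal C⋆-algebra is realised
inside the product of all models of the relation, as the C⋆-subalgebra generated by the two
tautological elements. `UniversalCStar.existsUnique_lift` is its universal property. -/

/-- A model of the relation `P`: a nonzero unital C⋆-algebra with two contractions satisfying `P`. -/
structure Model (P : ∀ (A : Type) [CStarAlgebra A], A → A → Prop) where
  carrier : Type
  [cstar : CStarAlgebra carrier]
  [nontriv : Nontrivial carrier]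
  fst : carrier
  snd : carrier
  rel : P carrier fst snd
  norm_fst : ‖fst‖ ≤ 1
  norm_snd : ‖snd‖ ≤ 1

attribute [instance] Model.cstar Model.nontriv

/-- The C⋆-algebra of all bounded families indexed by the models of `P`. -/
def Model.Prod (P : ∀ (A : Type) [CStarAlgebra A], A → A → Prop) : Type 1 :=
  lp (fun M : Model P => M.carrier) ∞

instance Model.prodCStarAlgebra (P : ∀ (A : Type) [CStarAlgebra A], A → A → Prop) :
    CStarAlgebra (Model.Prod P) :=
  { (inferInstance : NormedRing (lp (fun M : Model P => M.carrier) ∞)),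
    (inferInstance : StarRing (lp (fun M : Model P => M.carrier) ∞)),
    (inferInstance : CompleteSpace (lp (fun M : Model P => M.carrier) ∞)),
    (inferInstance : CStarRing (lp (fun M : Model P => M.carrier) ∞)),
    (inferInstance : NormedAlgebra ℂ (lp (fun M : Model P => M.carrier) ∞)),
    (inferInstance : StarModule ℂ (lp (fun M : Model P => M.carrier) ∞)) with }

section

variable (P : ∀ (A : Type) [CStarAlgebra A], A → A → Prop)

/-- The family of the first generators. -/
def Model.prodFst : Model.Prod P :=
  ⟨fun M => M.fst, memℓp_infty ⟨1, by rintro _ ⟨M, rfl⟩; exact M.norm_fst⟩⟩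

/-- The family of the second generators. -/
def Model.prodSnd : Model.Prod P :=
  ⟨fun M => M.snd, memℓp_infty ⟨1, by rintro _ ⟨M, rfl⟩; exact M.norm_snd⟩⟩

/-- Evaluation of a bounded family at a model. -/
def Model.eval (M : Model P) : Model.Prod P →⋆ₐ[ℂ] M.carrier where
  toFun a := a.1 M
  map_one' := rfl
  map_mul' _ _ := rfl
  map_zero' := rfl
  map_add' _ _ := rfl
  commutes' _ := rfl
  map_star' _ := rfl

/-- The closed star subalgebra generated by `a` and `b`. -/
def genSub {A : Type*} [CStarAlgebra A] (a b : A) : StarSubalgebra ℂ A :=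
  (StarAlgebra.adjoin ℂ {a, b}).topologicalClosure

theorem fst_mem_genSub {A : Type*} [CStarAlgebra A] (a b : A) : a ∈ genSub a b :=
  subset_closure (StarAlgebra.subset_adjoin ℂ _ (by simp))

theorem snd_mem_genSub {A : Type*} [CStarAlgebra A] (a b : A) : b ∈ genSub a b :=
  subset_closure (StarAlgebra.subset_adjoin ℂ _ (by simp))

/-- The unital C⋆-algebra generated by `a` and `b`. -/
def Generated {A : Type v} [CStarAlgebra A] (a b : A) : Type v := genSub a b

namespace Generated

variable {A : Type v} [CStarAlgebra A] (a b : A)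

instance : CStarAlgebra (Generated a b) :=
  StarSubalgebra.cstarAlgebra (S := StarSubalgebra ℂ A) (genSub a b)
    (h_closed := StarSubalgebra.isClosed_topologicalClosure _)

def fst : Generated a b := ⟨a, fst_mem_genSub a b⟩

def snd : Generated a b := ⟨b, snd_mem_genSub a b⟩

/-- The inclusion of `C⋆(a, b)` in the ambient algebra. -/
def subtype : Generated a b →⋆ₐ[ℂ] A where
  toFun x := x.1
  map_one' := rfl
  map_mul' _ _ := rfl
  map_zero' := rfl
  map_add' _ _ := rfl
  commutes' _ := rfl
  map_star' _ := rfl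

variable {a b}

theorem hom_ext {B : Type*} [CStarAlgebra B] {φ ψ : Generated a b →⋆ₐ[ℂ] B}
    (h₁ : φ (fst a b) = ψ (fst a b)) (h₂ : φ (snd a b) = ψ (snd a b)) : φ = ψ := by
  have hc : ∀ θ : Generated a b →⋆ₐ[ℂ] B, Continuous θ := fun θ =>
    AddMonoidHomClass.continuous_of_bound θ 1 fun x => by
      simpa only [one_mul] using NonUnitalStarAlgHom.norm_apply_le θ x
  have hφ := hc φ
  have hψ := hc ψ
  refine StarAlgHom.ext fun x => ?_
  have hx : x.1 ∈ closure (StarAlgebra.adjoin ℂ {a, b} : Set A) := x.2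
  have key : ∀ y (hy : y ∈ StarAlgebra.adjoin ℂ {a, b}),
      φ ⟨y, subset_closure hy⟩ = ψ ⟨y, subset_closure hy⟩ := by
    intro y hy
    induction hy using StarAlgebra.adjoin_induction with
    | mem z hz =>
      rcases (show z = a ∨ z = b from hz) with rfl | rfl
      · exact h₁
      · exact h₂
    | algebraMap r => exact (AlgHomClass.commutes φ r).trans (AlgHomClass.commutes ψ r).symm
    | add y z hy hz h h' =>
      exact (map_add φ ⟨y, subset_closure hy⟩ ⟨z, subset_closure hz⟩).trans
        ((congrArg₂ (· + ·) h h').trans (map_add ψ ⟨y, subset_closure hy⟩ ⟨z, subset_closure hz⟩).symm)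
    | mul y z hy hz h h' =>
      exact (map_mul φ ⟨y, subset_closure hy⟩ ⟨z, subset_closure hz⟩).trans
        ((congrArg₂ (· * ·) h h').trans (map_mul ψ ⟨y, subset_closure hy⟩ ⟨z, subset_closure hz⟩).symm)
    | star y hy h =>
      exact (map_star φ ⟨y, subset_closure hy⟩).trans
        ((congrArg star h).trans (map_star ψ ⟨y, subset_closure hy⟩).symm)
  obtain ⟨f, hf, hl⟩ := mem_closure_iff_seq_limit.1 hx
  have hl' : Filter.Tendsto (fun n => (⟨f n, subset_closure (hf n)⟩ : Generated a b)) Filter.atTop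
      (nhds x) := tendsto_subtype_rng.2 hl
  refine tendsto_nhds_unique ((hφ.tendsto x).comp hl') ?_
  refine ((hψ.tendsto x).comp hl').congr fun n => ?_
  exact (key (f n) (hf n)).symm

end Generated

theorem small_generated {A : Type v} [CStarAlgebra A] (a b : A) :
    Small.{0} (Generated a b) := by
  have h1 : Small.{0} (StarAlgebra.adjoin ℂ {a, b} : StarSubalgebra ℂ A) := by
    have : ((StarAlgebra.adjoin ℂ {a, b} : StarSubalgebra ℂ A) : Set A) =
        Set.range (FreeAlgebra.lift ℂ ![a, b, star a, star b]) := by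
      rw [← StarSubalgebra.coe_toSubalgebra, StarAlgebra.adjoin_toSubalgebra,
        ← AlgHom.coe_range, ← Algebra.adjoin_range_eq_range_freeAlgebra_lift]
      congr 2
      ext x
      simp only [Set.mem_union, Set.mem_star, Set.mem_insert_iff, Set.mem_singleton_iff,
        Set.mem_range, Fin.exists_fin_succ, Fin.exists_fin_zero]
      have h : ∀ y : A, star x = y ↔ star y = x := fun y => by rw [star_eq_iff_star_eq, eq_comm]
      simp [eq_comm (a := x), h, or_assoc]
    change Small.{0} ((StarAlgebra.adjoin ℂ {a, b} : StarSubalgebra ℂ A) : Set A)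
    rw [this]
    exact small_range _
  change Small.{0} (closure ((StarAlgebra.adjoin ℂ {a, b} : StarSubalgebra ℂ A) : Set A))
  set D := ((StarAlgebra.adjoin ℂ {a, b} : StarSubalgebra ℂ A) : Set A)
  have h1' : Small.{0} D := h1
  choose f hf hl using fun x : closure D => mem_closure_iff_seq_limit.1 x.2
  refine small_of_injective (f := fun x n => (⟨f x n, hf x n⟩ : D)) fun x y hxy => ?_
  have hfxy : f x = f y := funext fun n => congrArg Subtype.val (congrFun hxy n)
  exact Subtype.ext (tendsto_nhds_unique (hl x) (hfxy ▸ hl y))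

/-- The C⋆-algebra structure of a small C⋆-algebra, carried to its copy in the lowest universe. -/
@[reducible] def shrinkCStar (A : Type v) [CStarAlgebra A] [Small.{0} A] : CStarAlgebra (Shrink.{0} A) := by
  letI : NormedRing (Shrink.{0} A) := NormedRing.induced _ A (Shrink.ringEquiv A) (Shrink.ringEquiv A).injective
  letI : NormedAlgebra ℂ (Shrink.{0} A) := NormedAlgebra.induced ℂ _ A (Shrink.algEquiv ℂ A)
  letI : StarRing (Shrink.{0} A) :=
    { star := fun x => (Shrink.ringEquiv A).symm (star (Shrink.ringEquiv A x))
      star_involutive := fun x => by simp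
      star_mul := fun x y => by simp
      star_add := fun x y => by simp }
  have hstar : ∀ x : Shrink.{0} A, Shrink.ringEquiv A (star x) = star (Shrink.ringEquiv A x) :=
    fun x => (Shrink.ringEquiv A).apply_symm_apply _
  have hnorm : ∀ x : Shrink.{0} A, ‖x‖ = ‖Shrink.ringEquiv A x‖ := fun x => rfl
  have hiso : Isometry (Shrink.ringEquiv A) := AddMonoidHomClass.isometry_of_norm _ fun x => (hnorm x).symm
  exact
  { complete := by
      have : CompleteSpace (Shrink.{0} A) :=
        (IsometryEquiv.mk (Shrink.ringEquiv A).toEquiv hiso).completeSpace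
      exact fun {f} => this.complete
    norm_mul_self_le := fun x => by
      rw [hnorm, hnorm, map_mul, hstar]
      exact CStarRing.norm_mul_self_le _
    star_smul := fun r x => by
      apply (Shrink.algEquiv ℂ A).injective
      have e : ∀ x, Shrink.algEquiv ℂ A x = Shrink.ringEquiv A x := fun x => rfl
      rw [map_smul, e, hstar, e, hstar, ← e, map_smul, star_smul]
      rfl }

/-- `C⋆(a, b)` is separable, hence has a copy in the lowest universe. -/
theorem exists_small_model {A : Type v} [CStarAlgebra A] (a b : A) :
    ∃ (B : Type) (_ : CStarAlgebra B) (φ : B →⋆ₐ[ℂ] A) (x y : B),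
      Function.Injective φ ∧ φ x = a ∧ φ y = b := by
  have := small_generated a b
  let _ := shrinkCStar (Generated a b)
  let e := Shrink.ringEquiv (Generated a b)
  let φ : Shrink.{0} (Generated a b) →⋆ₐ[ℂ] Generated a b :=
    { (Shrink.algEquiv ℂ (Generated a b) : Shrink.{0} (Generated a b) →ₐ[ℂ] Generated a b) with
      map_star' := fun x => e.apply_symm_apply _ }
  have hφ : ∀ x, φ (e.symm x) = x := fun x => e.apply_symm_apply _
  refine ⟨_, inferInstance, (Generated.subtype a b).comp φ, e.symm (Generated.fst a b),
    e.symm (Generated.snd a b), ?_, ?_, ?_⟩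
  · exact Subtype.val_injective.comp e.injective
  · exact congrArg Subtype.val (hφ _)
  · exact congrArg Subtype.val (hφ _)

/-- The universal C⋆-algebra of the relation `P`. -/
def UniversalCStar : Type 1 := Generated (Model.prodFst P) (Model.prodSnd P)

instance UniversalCStar.cstarAlgebra : CStarAlgebra (UniversalCStar P) :=
  inferInstanceAs (CStarAlgebra (Generated (Model.prodFst P) (Model.prodSnd P)))

def UniversalCStar.fst : UniversalCStar P := Generated.fst _ _

def UniversalCStar.snd : UniversalCStar P := Generated.snd _ _

/-- The representation of the universal algebra given by a model. -/
def UniversalCStar.proj (M : Model P) : UniversalCStar P →⋆ₐ[ℂ] M.carrier :=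
  (Model.eval P M).comp (Generated.subtype (Model.prodFst P) (Model.prodSnd P))

/-- The universal property, for target C⋆-algebras in an arbitrary universe. -/
theorem UniversalCStar.existsUnique_lift {B : Type v} [CStarAlgebra B] (a b : B)
    (ha : ‖a‖ ≤ 1) (hb : ‖b‖ ≤ 1)
    (hP : ∀ (A : Type) [CStarAlgebra A] (φ : A →⋆ₐ[ℂ] B) (x y : A), Function.Injective φ →
      φ x = a → φ y = b → P A x y) :
    ∃! ψ : UniversalCStar P →⋆ₐ[ℂ] B, ψ (UniversalCStar.fst P) = a ∧ ψ (UniversalCStar.snd P) = b := by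
  refine existsUnique_of_exists_of_unique ?_ fun φ ψ hφ hψ =>
    Generated.hom_ext (a := Model.prodFst P) (b := Model.prodSnd P) (hφ.1.trans hψ.1.symm)
      (hφ.2.trans hψ.2.symm)
  obtain ⟨A, _, φ, x, y, hφ, hx, hy⟩ := exists_small_model a b
  rcases subsingleton_or_nontrivial B with hB | hB
  · exact ⟨{ toFun := fun _ => 0, map_one' := Subsingleton.elim _ _, map_mul' := fun _ _ => Subsingleton.elim _ _,
             map_zero' := rfl, map_add' := fun _ _ => Subsingleton.elim _ _,
             commutes' := fun _ => Subsingleton.elim _ _, map_star' := fun _ => Subsingleton.elim _ _ },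
      Subsingleton.elim _ _, Subsingleton.elim _ _⟩
  · have : Nontrivial A := φ.toRingHom.domain_nontrivial
    have hn : ∀ z, ‖φ z‖ = ‖z‖ := NonUnitalStarAlgHom.norm_map φ hφ
    let M : Model P := ⟨A, x, y, hP A φ x y hφ hx hy, by rw [← hn, hx]; exact ha,
      by rw [← hn, hy]; exact hb⟩
    exact ⟨(φ.comp (Model.eval P M)).comp (Generated.subtype (Model.prodFst P) (Model.prodSnd P)),
      hx, hy⟩

theorem UniversalCStar.ext_proj {x y : UniversalCStar P}
    (h : ∀ M : Model P, UniversalCStar.proj P M x = UniversalCStar.proj P M y) : x = y :=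
  Subtype.ext (Subtype.ext (funext h))

end

/-! ### The Cuntz algebra `𝒪₂`, the `2`-adic ring C⋆-algebra `𝒬₂`, and the embedding -/


/-- `x₁`, `x₂` are isometries with `x₁x₁* + x₂x₂* = 1`. -/
def IsCuntzPair {A : Type*} [CStarAlgebra A] (x₁ x₂ : A) : Prop :=
  star x₁ * x₁ = 1 ∧ star x₂ * x₂ = 1 ∧ x₁ * star x₁ + x₂ * star x₂ = 1

/-- `u` is unitary, `s` is an isometry, `su = u²s` and `ss* + uss*u* = 1`. -/
def IsTwoAdicPair {A : Type*} [CStarAlgebra A] (u s : A) : Prop :=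
  star u * u = 1 ∧ u * star u = 1 ∧ star s * s = 1 ∧ s * u = u ^ 2 * s ∧
    s * star s + u * s * star s * star u = 1

theorem norm_le_one_of_isometry {A : Type*} [CStarAlgebra A] {x : A} (h : star x * x = 1) :
    ‖x‖ ≤ 1 := by
  have h1 : ‖x‖ * ‖x‖ = ‖(1 : A)‖ := by rw [← CStarRing.norm_star_mul_self, h]
  rcases subsingleton_or_nontrivial A with hA | hA
  · rw [Subsingleton.elim x 0, norm_zero]; exact zero_le_one
  · rw [CStarRing.norm_one] at h1
    nlinarith [norm_nonneg x]

/-- The defining relation of `𝒪₂`. -/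
abbrev cuntzRelation (A : Type) [CStarAlgebra A] (x₁ x₂ : A) : Prop := IsCuntzPair x₁ x₂

/-- The Cuntz algebra `𝒪₂`, universal for two isometries with `S₁S₁* + S₂S₂* = 1`. -/
abbrev O2 : Type 1 := UniversalCStar cuntzRelation

/-- The first generating isometry of `𝒪₂`. -/
def O2.S₁ : O2 := UniversalCStar.fst _

/-- The second generating isometry of `𝒪₂`. -/
def O2.S₂ : O2 := UniversalCStar.snd _

theorem O2.isCuntzPair : IsCuntzPair O2.S₁ O2.S₂ := by
  refine ⟨UniversalCStar.ext_proj cuntzRelation fun M => ?_, UniversalCStar.ext_proj cuntzRelation fun M => ?_, UniversalCStar.ext_proj cuntzRelation fun M => ?_⟩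
  · simp only [map_mul, map_star, map_one]
    exact M.rel.1
  · simp only [map_mul, map_star, map_one]
    exact M.rel.2.1
  · simp only [map_mul, map_star, map_one, map_add]
    exact M.rel.2.2

theorem O2.existsUnique_lift {B : Type v} [CStarAlgebra B] (x₁ x₂ : B) (h : IsCuntzPair x₁ x₂) :
    ∃! φ : O2 →⋆ₐ[ℂ] B, φ O2.S₁ = x₁ ∧ φ O2.S₂ = x₂ := by
  refine UniversalCStar.existsUnique_lift _ x₁ x₂ (norm_le_one_of_isometry h.1)
    (norm_le_one_of_isometry h.2.1) ?_
  rintro A _ φ x y hφ rfl rfl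
  refine ⟨hφ ?_, hφ ?_, hφ ?_⟩
  · simpa only [map_mul, map_star, map_one] using h.1
  · simpa only [map_mul, map_star, map_one] using h.2.1
  · simpa only [map_mul, map_star, map_one, map_add] using h.2.2

/-- The defining relation of `𝒬₂`. -/
abbrev twoAdicRelation (A : Type) [CStarAlgebra A] (u s : A) : Prop := IsTwoAdicPair u s

/-- The `2`-adic ring C⋆-algebra `𝒬₂`, universal for a unitary `U` and an isometry `S₂` with
`S₂U = U²S₂` and `S₂S₂* + US₂S₂*U* = 1`. -/
abbrev Q2 : Type 1 := UniversalCStar twoAdicRelation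

/-- The generating unitary of `𝒬₂`. -/
def Q2.U : Q2 := UniversalCStar.fst _

/-- The generating isometry of `𝒬₂`. -/
def Q2.S₂ : Q2 := UniversalCStar.snd _

theorem Q2.isTwoAdicPair : IsTwoAdicPair Q2.U Q2.S₂ := by
  refine ⟨UniversalCStar.ext_proj twoAdicRelation fun M => ?_, UniversalCStar.ext_proj twoAdicRelation fun M => ?_, UniversalCStar.ext_proj twoAdicRelation fun M => ?_,
    UniversalCStar.ext_proj twoAdicRelation fun M => ?_, UniversalCStar.ext_proj twoAdicRelation fun M => ?_⟩
  · simp only [map_mul, map_star, map_one]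
    exact M.rel.1
  · simp only [map_mul, map_star, map_one]
    exact M.rel.2.1
  · simp only [map_mul, map_star, map_one]
    exact M.rel.2.2.1
  · simp only [map_mul, map_pow]
    exact M.rel.2.2.2.1
  · simp only [map_mul, map_star, map_one, map_add]
    exact M.rel.2.2.2.2

theorem Q2.existsUnique_lift {B : Type v} [CStarAlgebra B] (u s : B) (h : IsTwoAdicPair u s) :
    ∃! φ : Q2 →⋆ₐ[ℂ] B, φ Q2.U = u ∧ φ Q2.S₂ = s := by
  refine UniversalCStar.existsUnique_lift _ u s (norm_le_one_of_isometry h.1)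
    (norm_le_one_of_isometry h.2.2.1) ?_
  rintro A _ φ x y hφ rfl rfl
  refine ⟨hφ ?_, hφ ?_, hφ ?_, hφ ?_, hφ ?_⟩
  · simpa only [map_mul, map_star, map_one] using h.1
  · simpa only [map_mul, map_star, map_one] using h.2.1
  · simpa only [map_mul, map_star, map_one] using h.2.2.1
  · simpa only [map_mul, map_pow] using h.2.2.2.1
  · simpa only [map_mul, map_star, map_one, map_add] using h.2.2.2.2

theorem IsTwoAdicPair.isCuntzPair {A : Type*} [CStarAlgebra A] {u s : A}
    (h : IsTwoAdicPair u s) : IsCuntzPair (u * s) s := by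
  obtain ⟨h1, _, h3, _, h5⟩ := h
  refine ⟨?_, h3, ?_⟩
  · rw [star_mul, mul_assoc, ← mul_assoc (star u), h1, one_mul, h3]
  · rw [star_mul, add_comm, ← h5]
    simp only [mul_assoc]

/-- The embedding `𝒪₂ → 𝒬₂` with `S₁ ↦ US₂` and `S₂ ↦ S₂`. -/
def embed : O2 →⋆ₐ[ℂ] Q2 :=
  (O2.existsUnique_lift (Q2.U * Q2.S₂) Q2.S₂ Q2.isTwoAdicPair.isCuntzPair).choose

theorem embed_S₁ : embed O2.S₁ = Q2.U * Q2.S₂ :=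
  (O2.existsUnique_lift (Q2.U * Q2.S₂) Q2.S₂ Q2.isTwoAdicPair.isCuntzPair).choose_spec.1.1

theorem embed_S₂ : embed O2.S₂ = Q2.S₂ :=
  (O2.existsUnique_lift (Q2.U * Q2.S₂) Q2.S₂ Q2.isTwoAdicPair.isCuntzPair).choose_spec.1.2

/-! ### The canonical representation of `𝒬₂` on `ℓ²(ℤ)` -/


/-- The Hilbert space `ℓ²(ℤ)`. -/
abbrev ell2Z : Type := lp (fun _ : ℤ => ℂ) 2

/-- The canonical orthonormal basis of `ℓ²(ℤ)`. -/
def basisZ : HilbertBasis ℤ ℂ ell2Z := ⟨LinearIsometryEquiv.refl ℂ _⟩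

theorem basisZ_ext {f g : ell2Z →L[ℂ] ell2Z} (h : ∀ k, f (basisZ k) = g (basisZ k)) : f = g :=
  ContinuousLinearMap.ext_on (Submodule.dense_iff_topologicalClosure_eq_top.2 basisZ.dense_span)
    (by rintro _ ⟨k, rfl⟩; exact h k)

/-- The isometry of `ℓ²(ℤ)` with `e k ↦ e (f k)`. -/
def shiftOp (f : ℤ → ℤ) (hf : Function.Injective f) : ell2Z →L[ℂ] ell2Z :=
  ((basisZ.orthonormal.comp f hf).orthogonalFamily.linearIsometry).toContinuousLinearMap

theorem shiftOp_apply (f : ℤ → ℤ) (hf : Function.Injective f) (k : ℤ) :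
    shiftOp f hf (basisZ k) = basisZ (f k) := by
  classical
  have h : basisZ k = lp.single 2 k (1 : ℂ) := by
    rw [← basisZ.repr_symm_single]; rfl
  have h2 := (basisZ.orthonormal.comp f hf).orthogonalFamily.linearIsometry_apply_single
    (i := k) (1 : ℂ)
  rw [h]
  refine h2.trans ?_
  simp

theorem ext_inner_basisZ {x y : ell2Z} (h : ∀ j, ⟪basisZ j, x⟫_ℂ = ⟪basisZ j, y⟫_ℂ) : x = y := by
  apply basisZ.repr.injective
  ext j
  rw [basisZ.repr_apply_apply, basisZ.repr_apply_apply, h]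

theorem inner_star_shiftOp (f : ℤ → ℤ) (hf : Function.Injective f) (j k : ℤ) :
    ⟪basisZ j, star (shiftOp f hf) (basisZ k)⟫_ℂ = if f j = k then 1 else 0 := by
  rw [ContinuousLinearMap.star_eq_adjoint, ContinuousLinearMap.adjoint_inner_right, shiftOp_apply,
    orthonormal_iff_ite.1 basisZ.orthonormal]

theorem star_shiftOp_apply (f : ℤ → ℤ) (hf : Function.Injective f) (k : ℤ) :
    star (shiftOp f hf) (basisZ (f k)) = basisZ k := by
  refine ext_inner_basisZ fun j => ?_
  rw [inner_star_shiftOp, orthonormal_iff_ite.1 basisZ.orthonormal]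
  simp [hf.eq_iff]

theorem star_shiftOp_apply_of_ne (f : ℤ → ℤ) (hf : Function.Injective f) (k : ℤ)
    (hk : ∀ j, f j ≠ k) : star (shiftOp f hf) (basisZ k) = 0 := by
  refine ext_inner_basisZ fun j => ?_
  rw [inner_star_shiftOp, inner_zero_right, if_neg (hk j)]

/-- `e k ↦ e (k + 1)`. -/
def canonicalU : ell2Z →L[ℂ] ell2Z := shiftOp (fun k => k + 1) (add_left_injective 1)

/-- `e k ↦ e (2 * k)`. -/
def canonicalS₂ : ell2Z →L[ℂ] ell2Z :=
  shiftOp (fun k => 2 * k) (mul_right_injective₀ two_ne_zero)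

theorem canonicalU_apply (k : ℤ) : canonicalU (basisZ k) = basisZ (k + 1) := shiftOp_apply _ _ k

theorem canonicalS₂_apply (k : ℤ) : canonicalS₂ (basisZ k) = basisZ (2 * k) := shiftOp_apply _ _ k

theorem star_canonicalU_apply (k : ℤ) : star canonicalU (basisZ k) = basisZ (k - 1) := by
  have h := star_shiftOp_apply (fun k => k + 1) (add_left_injective 1) (k - 1)
  simp only [sub_add_cancel] at h
  exact h

theorem star_canonicalS₂_even (k : ℤ) : star canonicalS₂ (basisZ (2 * k)) = basisZ k :=
  star_shiftOp_apply _ _ k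

theorem star_canonicalS₂_odd (k : ℤ) : star canonicalS₂ (basisZ (2 * k + 1)) = 0 :=
  star_shiftOp_apply_of_ne _ _ _ fun j => by omega

theorem canonical_isTwoAdicPair : IsTwoAdicPair canonicalU canonicalS₂ := by
  refine ⟨basisZ_ext fun k => ?_, basisZ_ext fun k => ?_, basisZ_ext fun k => ?_,
    basisZ_ext fun k => ?_, basisZ_ext fun k => ?_⟩
  · change star canonicalU (canonicalU (basisZ k)) = basisZ k
    rw [canonicalU_apply, star_canonicalU_apply, add_sub_cancel_right]
  · change canonicalU (star canonicalU (basisZ k)) = basisZ k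
    rw [star_canonicalU_apply, canonicalU_apply, sub_add_cancel]
  · change star canonicalS₂ (canonicalS₂ (basisZ k)) = basisZ k
    rw [canonicalS₂_apply, star_canonicalS₂_even]
  · rw [pow_two]
    change canonicalS₂ (canonicalU (basisZ k)) = canonicalU (canonicalU (canonicalS₂ (basisZ k)))
    simp only [canonicalU_apply, canonicalS₂_apply]
    congr 1
    ring
  · change canonicalS₂ (star canonicalS₂ (basisZ k)) +
      canonicalU (canonicalS₂ (star canonicalS₂ (star canonicalU (basisZ k)))) = basisZ k
    rw [star_canonicalU_apply]
    rcases Int.even_or_odd' k with ⟨m, rfl | rfl⟩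
    · have h : 2 * m - 1 = 2 * (m - 1) + 1 := by ring
      rw [star_canonicalS₂_even, canonicalS₂_apply, h, star_canonicalS₂_odd, map_zero, map_zero,
        add_zero]
    · rw [star_canonicalS₂_odd, add_sub_cancel_right, star_canonicalS₂_even, canonicalS₂_apply,
        canonicalU_apply, map_zero, zero_add]

/-- The canonical representation `ρ_c` of `𝒬₂`. -/
def canonicalRep : Q2 →⋆ₐ[ℂ] (ell2Z →L[ℂ] ell2Z) :=
  (Q2.existsUnique_lift canonicalU canonicalS₂ canonical_isTwoAdicPair).choose

theorem canonicalRep_U : canonicalRep Q2.U = canonicalU :=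
  (Q2.existsUnique_lift canonicalU canonicalS₂ canonical_isTwoAdicPair).choose_spec.1.1

theorem canonicalRep_S₂ : canonicalRep Q2.S₂ = canonicalS₂ :=
  (Q2.existsUnique_lift canonicalU canonicalS₂ canonical_isTwoAdicPair).choose_spec.1.2

/-! ### Words, branching function systems and the coding map -/

/-- The alphabet `{1, 2}`. -/
inductive Letter : Type
  | one
  | two

/-- `S_i`. -/
def O2.gen : Letter → O2
  | Letter.one => O2.S₁
  | Letter.two => O2.S₂

/-- `S_w = S_{i₁} ⋯ S_{i_k}` for `w = (i₁, …, i_k)`. -/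
def O2.word (w : List Letter) : O2 := (w.map O2.gen).prod

/-- `(σ₁, σ₂)` is a branching function system of order `2`: both maps are injective and their
ranges partition `ℕ`. -/
structure IsBranching (σ : Letter → ℕ → ℕ) : Prop where
  injective : ∀ i, Function.Injective (σ i)
  disjoint : Disjoint (Set.range (σ Letter.one)) (Set.range (σ Letter.two))
  union_eq : Set.range (σ Letter.one) ∪ Set.range (σ Letter.two) = Set.univ

/-- `σ_{i₁} ∘ ⋯ ∘ σ_{i_k}` for `w = (i₁, …, i_k)`. -/
def wordMap (σ : Letter → ℕ → ℕ) (w : List Letter) : ℕ → ℕ :=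
  w.foldr (fun i f => σ i ∘ f) id

/-- The word of the first `k` letters of a sequence. -/
def prefixWord (s : ℕ → Letter) (k : ℕ) : List Letter := List.ofFn fun j : Fin k => s j

/-- `n` lies in the range of `σ_{s₁} ∘ ⋯ ∘ σ_{s_k}` for every `k`. -/
def IsCode (σ : Letter → ℕ → ℕ) (n : ℕ) (s : ℕ → Letter) : Prop :=
  ∀ k, n ∈ Set.range (wordMap σ (prefixWord s k))

theorem prefixWord_succ (s : ℕ → Letter) (k : ℕ) :
    prefixWord s (k + 1) = s 0 :: prefixWord (fun j => s (j + 1)) k := by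
  simp [prefixWord, List.ofFn_succ]

theorem IsBranching.exists_eq {σ : Letter → ℕ → ℕ} (h : IsBranching σ) (n : ℕ) :
    ∃ p : Letter × ℕ, σ p.1 p.2 = n := by
  rcases (h.union_eq ▸ Set.mem_univ n : n ∈ Set.range (σ Letter.one) ∪ Set.range (σ Letter.two))
    with ⟨m, hm⟩ | ⟨m, hm⟩
  · exact ⟨(Letter.one, m), hm⟩
  · exact ⟨(Letter.two, m), hm⟩

theorem IsBranching.eq_of_eq {σ : Letter → ℕ → ℕ} (h : IsBranching σ) {i j : Letter} {m n : ℕ}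
    (hmn : σ i m = σ j n) : i = j ∧ m = n := by
  have hd := fun a b (hab : σ Letter.one a = σ Letter.two b) =>
    Set.disjoint_left.1 h.disjoint ⟨a, hab⟩ ⟨b, rfl⟩
  cases i <;> cases j
  · exact ⟨rfl, h.injective _ hmn⟩
  · exact (hd _ _ hmn).elim
  · exact (hd _ _ hmn.symm).elim
  · exact ⟨rfl, h.injective _ hmn⟩

theorem isCode_iff {σ : Letter → ℕ → ℕ} (h : IsBranching σ) {i : Letter} {m : ℕ}
    {s : ℕ → Letter} :
    IsCode σ (σ i m) s ↔ s 0 = i ∧ IsCode σ m fun j => s (j + 1) := by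
  constructor
  · intro hs
    have key : ∀ k, s 0 = i ∧ m ∈ Set.range (wordMap σ (prefixWord (fun j => s (j + 1)) k)) := by
      intro k
      obtain ⟨a, ha⟩ := hs (k + 1)
      rw [prefixWord_succ] at ha
      obtain ⟨h1, h2⟩ := h.eq_of_eq (show σ (s 0) (wordMap σ _ a) = σ i m from ha)
      exact ⟨h1, a, h2⟩
    exact ⟨(key 0).1, fun k => (key k).2⟩
  · rintro ⟨rfl, hs⟩ k
    cases k with
    | zero => exact ⟨_, rfl⟩
    | succ k =>
      obtain ⟨a, ha⟩ := hs k
      refine ⟨a, ?_⟩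
      rw [prefixWord_succ]
      exact congrArg (σ (s 0)) ha

theorem existsUnique_isCode {σ : Letter → ℕ → ℕ} (h : IsBranching σ) (n : ℕ) :
    ∃! s, IsCode σ n s := by
  choose p hp using h.exists_eq
  refine ⟨fun k => (p ((fun m => (p m).2)^[k] n)).1, ?_, ?_⟩
  · intro k
    induction k generalizing n with
    | zero => exact ⟨n, rfl⟩
    | succ k ih =>
      obtain ⟨a, ha⟩ := ih (p n).2
      refine ⟨a, ?_⟩
      rw [prefixWord_succ]
      exact (congrArg (σ (p n).1) ha).trans (hp n)
  · intro s hs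
    funext k
    induction k generalizing n s with
    | zero =>
      rw [← hp n, isCode_iff h] at hs
      exact hs.1
    | succ k ih =>
      rw [← hp n, isCode_iff h] at hs
      exact ih (p n).2 _ hs.2

/-- The coding map: `codingMap h n` is the only sequence `s` such that `n` lies in the range of
`σ_{s₁} ∘ ⋯ ∘ σ_{s_k}` for every `k`. -/
def codingMap {σ : Letter → ℕ → ℕ} (h : IsBranching σ) (n : ℕ) : ℕ → Letter :=
  (existsUnique_isCode h n).choose

theorem isCode_codingMap {σ : Letter → ℕ → ℕ} (h : IsBranching σ) (n : ℕ) :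
    IsCode σ n (codingMap h n) :=
  (existsUnique_isCode h n).choose_spec.1

/-! ### Representations -/

section

variable {A : Type*} [CStarAlgebra A]
  {H : Type u} [NormedAddCommGroup H] [InnerProductSpace ℂ H] [CompleteSpace H]
  {K : Type v} [NormedAddCommGroup K] [InnerProductSpace ℂ K] [CompleteSpace K]

/-- The representation space is nonzero and has no closed invariant subspace except `0` and
itself. -/
def IsIrreducibleRep (π : A →⋆ₐ[ℂ] (H →L[ℂ] H)) : Prop :=
  Nontrivial H ∧ ∀ M : Submodule ℂ H, IsClosed (M : Set H) → (∀ a, ∀ x ∈ M, π a x ∈ M) →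
    M = ⊥ ∨ M = ⊤

/-- Unitary equivalence of representations. -/
def UnitarilyEquivalent (π : A →⋆ₐ[ℂ] (H →L[ℂ] H)) (π' : A →⋆ₐ[ℂ] (K →L[ℂ] K)) : Prop :=
  ∃ V : H ≃ₗᵢ[ℂ] K, ∀ a x, V (π a x) = π' a (V x)

/-- `x` is a cyclic vector for `π`. -/
def IsCyclicVector (π : A →⋆ₐ[ℂ] (H →L[ℂ] H)) (x : H) : Prop :=
  Dense (Set.range fun a => π a x)

/-- The restriction to `𝒪₂` of a representation of `𝒬₂`. -/
def restrict (ρ : Q2 →⋆ₐ[ℂ] (H →L[ℂ] H)) : O2 →⋆ₐ[ℂ] (H →L[ℂ] H) := ρ.comp embed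

/-- The representation `ρ` of `𝒬₂` is permutative: on some orthonormal basis `(e n)` one has
`ρ(S₂) e n = e (σ₂ n)` and `ρ(U) e n = e (τ n)`, where `σ₂` is injective and `τ` bijective. -/
def IsPermutativeQ2 (ρ : Q2 →⋆ₐ[ℂ] (H →L[ℂ] H)) : Prop :=
  ∃ (e : HilbertBasis ℕ ℂ H) (σ₂ τ : ℕ → ℕ), Function.Injective σ₂ ∧ Function.Bijective τ ∧
    ∀ n, ρ Q2.S₂ (e n) = e (σ₂ n) ∧ ρ Q2.U (e n) = e (τ n)

/-- The representation `π` of `𝒪₂` acts on the orthonormal basis `(e n)` through the branching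
function system `(σ₁, σ₂)`, that is `π(S_i) e n = e (σ_i n)`. -/
structure IsPermutationBasis (π : O2 →⋆ₐ[ℂ] (H →L[ℂ] H)) (e : HilbertBasis ℕ ℂ H)
    (σ : Letter → ℕ → ℕ) : Prop where
  branching : IsBranching σ
  map_basis : ∀ i n, π (O2.gen i) (e n) = e (σ i n)

/-- The representation `π` of `𝒪₂` is permutative. -/
def IsPermutativeO2 (π : O2 →⋆ₐ[ℂ] (H →L[ℂ] H)) : Prop :=
  ∃ e σ, IsPermutationBasis π e σ

/-- The permutative representation `π` of `𝒪₂` is multiplicity-free in the sense of Bratteli and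
Jorgensen: its coding map is injective, whatever basis is used to exhibit `π` as permutative. -/
def IsMultiplicityFree (π : O2 →⋆ₐ[ℂ] (H →L[ℂ] H)) : Prop :=
  IsPermutativeO2 π ∧ ∀ (e : HilbertBasis ℕ ℂ H) (σ : Letter → ℕ → ℕ)
    (h : IsPermutationBasis π e σ), Function.Injective (codingMap h.branching)

/-- Finite nonempty or infinite multi-indices in the alphabet `{1, 2}`. -/
inductive MultiIndex : Type
  | finite (w : List Letter) (hw : w ≠ []) : MultiIndex
  | infinite (s : ℕ → Letter) : MultiIndex

/-- The multi-index of length one with entry `i`. -/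
def MultiIndex.single (i : Letter) : MultiIndex := MultiIndex.finite [i] (List.cons_ne_nil i [])

/-- The condition on the vector `x` in the definition of the representation of type `P(I)`.
For `I = (i₁, …, i_k)` finite: `S_I x = x`, and `x, S_{i₁} x, …, S_{i₁} ⋯ S_{i_{k-1}} x` is
orthonormal. For `I = (i₁, i₂, …)` infinite: `x, S_{i₁}* x, S_{i₂}* S_{i₁}* x, …` is orthonormal
(so that none of these vectors vanishes). -/
def IsTypePVector (π : O2 →⋆ₐ[ℂ] (H →L[ℂ] H)) (x : H) : MultiIndex → Prop
  | MultiIndex.finite w _ => π (O2.word w) x = x ∧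
      Orthonormal ℂ fun j : Fin w.length => π (O2.word (w.take j)) x
  | MultiIndex.infinite s =>
      Orthonormal ℂ fun k : ℕ => π (star (O2.word (prefixWord s k))) x

/-- `π` is a representation of type `P(I)`: it is permutative, with a cyclic basis vector
satisfying `IsTypePVector`. -/
def IsTypeP (π : O2 →⋆ₐ[ℂ] (H →L[ℂ] H)) (I : MultiIndex) : Prop :=
  ∃ (e : HilbertBasis ℕ ℂ H) (σ : Letter → ℕ → ℕ), IsPermutationBasis π e σ ∧
    ∃ n, IsCyclicVector π (e n) ∧ IsTypePVector π (e n) I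

end

end TwoAdic

end

open TwoAdic

universe u v


/-!
Write `T` for the shift of the branching function system of a permutative representation of `𝒪₂`,
that is, the common left inverse of `σ₁` and `σ₂`. From `U S₂ = S₁` and `U S₁ = S₂ U` one sees that
`U` acts on basis indices as an odometer: it changes the finite initial piece `1⋯12` of a code into
`2⋯21`, and so `U` is determined by the restriction to `𝒪₂` away from the indices with code `1^∞`.

If the code `1^∞` does not occur, every operator intertwining the restrictions therefore intertwines
`U`, so irreducibility and equivalence pass from `𝒬₂` to `𝒪₂` and extensions are unique. If neither
`1^∞` nor `2^∞` occurs, carrying over is always defined and the odometer exists, which gives the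
extension. In an irreducible representation of type `P(I)` such codes occur only for `I = (1)`
and `I = (2)`.

If the code `1^∞` does occur and the representation of `𝒬₂` is irreducible, then every code is
eventually constant. Then there is a permutation `φ` of the indices that commutes with `σ₁` and
`σ₂`, preserves codes, and satisfies `T^k ∘ φ = T^(k+1)` for large `k` at each index; it
commutes with the odometer as well, hence is the identity by Schur's lemma. So `σ₂` has a fixed
point `m`, and `k ↦ U^k e_m` identifies the representation with the canonical one.

Schur's lemma gives the injectivity of the coding map of an irreducible permutative representation
of `𝒪₂` in the same way: given two indices with equal codes, a permutation commuting with `σ₁` and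
`σ₂` carries one into the other.
-/

namespace TwoAdic

/-! ### Generators, irreducibility and cyclicity -/

section Generation

open scoped CStarAlgebra

theorem Generated.eq_top_of_isClosed {A : Type v} [CStarAlgebra A] {a b : A}
    {T : StarSubalgebra ℂ (Generated a b)} (hT : IsClosed (T : Set (Generated a b)))
    (ha : Generated.fst a b ∈ T) (hb : Generated.snd a b ∈ T) : T = ⊤ := by
  have hclosed : IsClosed (T.map (Generated.subtype a b) : Set A) :=
    isClosed_closure.isClosedMap_subtype_val _ hT
  have hle : genSub a b ≤ T.map (Generated.subtype a b) :=
    StarSubalgebra.topologicalClosure_minimal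
      (StarAlgebra.adjoin_le <| Set.pair_subset ⟨_, ha, rfl⟩ ⟨_, hb, rfl⟩) hclosed
  refine eq_top_iff.2 fun x _ => ?_
  obtain ⟨y, hy, hyx⟩ := hle x.2
  exact Subtype.ext hyx ▸ hy

variable {P : ∀ (A : Type) [CStarAlgebra A], A → A → Prop}
  {H : Type u} [NormedAddCommGroup H] [InnerProductSpace ℂ H] [CompleteSpace H]
  {K : Type v} [NormedAddCommGroup K] [InnerProductSpace ℂ K] [CompleteSpace K]

/-- The elements `a` such that `B` intertwines both `π a` with `π' a` and `π (star a)` with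
`π' (star a)`; the second condition makes this a star subalgebra. -/
def intertwinedSubalgebra {A : Type*} [CStarAlgebra A] (π : A →⋆ₐ[ℂ] (H →L[ℂ] H))
    (π' : A →⋆ₐ[ℂ] (K →L[ℂ] K)) (B : H →L[ℂ] K) : StarSubalgebra ℂ A where
  carrier := {a | B ∘L π a = π' a ∘L B ∧ B ∘L π (star a) = π' (star a) ∘L B}
  mul_mem' {a b} ha hb := by
    have hmul {c d : A} (hc : B ∘L π c = π' c ∘L B) (hd : B ∘L π d = π' d ∘L B) :
        B ∘L π (c * d) = π' (c * d) ∘L B := by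
      rw [map_mul, map_mul, ContinuousLinearMap.mul_def, ContinuousLinearMap.mul_def,
        ← ContinuousLinearMap.comp_assoc, hc, ContinuousLinearMap.comp_assoc, hd,
        ContinuousLinearMap.comp_assoc]
    exact ⟨hmul ha.1 hb.1, star_mul a b ▸ hmul hb.2 ha.2⟩
  add_mem' {a b} ha hb := by
    simp only [Set.mem_ofPred_eq, star_add, map_add, ContinuousLinearMap.comp_add,
      ContinuousLinearMap.add_comp, ha.1, ha.2, hb.1, hb.2, and_self]
  algebraMap_mem' r := by
    have hscalar (c : ℂ) : B ∘L π (algebraMap ℂ A c) = π' (algebraMap ℂ A c) ∘L B := by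
      rw [AlgHomClass.commutes, AlgHomClass.commutes]
      ext x
      exact map_smul B c x
    exact ⟨hscalar r, algebraMap_star_comm (A := A) r ▸ hscalar (star r)⟩
  star_mem' {a} ha := ⟨ha.2, (star_star a).symm ▸ ha.1⟩

theorem isClosed_intertwinedSubalgebra {A : Type*} [CStarAlgebra A]
    (π : A →⋆ₐ[ℂ] (H →L[ℂ] H)) (π' : A →⋆ₐ[ℂ] (K →L[ℂ] K)) (B : H →L[ℂ] K) :
    IsClosed (intertwinedSubalgebra π π' B : Set A) := by
  have hπ : Continuous π := map_continuous π
  have hπ' : Continuous π' := map_continuous π'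
  exact (isClosed_eq (by fun_prop) (by fun_prop)).inter (isClosed_eq (by fun_prop) (by fun_prop))

theorem intertwines_of_generators {π : UniversalCStar P →⋆ₐ[ℂ] (H →L[ℂ] H)}
    {π' : UniversalCStar P →⋆ₐ[ℂ] (K →L[ℂ] K)} {B : H →L[ℂ] K}
    (h₁ : B ∘L π (UniversalCStar.fst P) = π' (UniversalCStar.fst P) ∘L B)
    (h₂ : B ∘L π (UniversalCStar.snd P) = π' (UniversalCStar.snd P) ∘L B)
    (h₁' : B ∘L star (π (UniversalCStar.fst P)) = star (π' (UniversalCStar.fst P)) ∘L B)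
    (h₂' : B ∘L star (π (UniversalCStar.snd P)) = star (π' (UniversalCStar.snd P)) ∘L B)
    (a : UniversalCStar P) : B ∘L π a = π' a ∘L B := by
  have htop : intertwinedSubalgebra π π' B = ⊤ := by
    refine Generated.eq_top_of_isClosed (isClosed_intertwinedSubalgebra π π' B) ⟨h₁, ?_⟩ ⟨h₂, ?_⟩
    · rwa [← map_star π, ← map_star π'] at h₁'
    · rwa [← map_star π, ← map_star π'] at h₂'
  exact (htop ▸ StarSubalgebra.mem_top : a ∈ intertwinedSubalgebra π π' B).1

theorem starProjection_comp_comm {M : Submodule ℂ H} [M.HasOrthogonalProjection] {A : H →L[ℂ] H}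
    (hA : ∀ x ∈ M, A x ∈ M) (hA' : ∀ x ∈ M, star A x ∈ M) :
    M.starProjection ∘L A = A ∘L M.starProjection := by
  ext x
  refine Submodule.eq_starProjection_of_mem_of_inner_eq_zero
    (hA _ (M.starProjection_apply_mem x)) fun w hw => ?_
  calc ⟪A x - A (M.starProjection x), w⟫_ℂ = ⟪x - M.starProjection x, star A w⟫_ℂ := by
        rw [← map_sub, ContinuousLinearMap.star_eq_adjoint,
          ContinuousLinearMap.adjoint_inner_right]
    _ = 0 := M.starProjection_inner_eq_zero x _ (hA' w hw)

theorem apply_mem_of_generators {π : UniversalCStar P →⋆ₐ[ℂ] (H →L[ℂ] H)} {M : Submodule ℂ H}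
    (hM : IsClosed (M : Set H))
    (h₁ : ∀ x ∈ M, π (UniversalCStar.fst P) x ∈ M)
    (h₂ : ∀ x ∈ M, π (UniversalCStar.snd P) x ∈ M)
    (h₁' : ∀ x ∈ M, star (π (UniversalCStar.fst P)) x ∈ M)
    (h₂' : ∀ x ∈ M, star (π (UniversalCStar.snd P)) x ∈ M)
    (a : UniversalCStar P) {x : H} (hx : x ∈ M) : π a x ∈ M := by
  have : CompleteSpace M := hM.completeSpace_coe
  have hcomm := intertwines_of_generators (starProjection_comp_comm h₁ h₁')
    (starProjection_comp_comm h₂ h₂') (starProjection_comp_comm h₁' (by rwa [star_star]))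
    (starProjection_comp_comm h₂' (by rwa [star_star])) a
  have hfix : M.starProjection (π a x) = π a x := by
    simpa only [ContinuousLinearMap.comp_apply, Submodule.starProjection_eq_self_iff.2 hx]
      using DFunLike.congr_fun hcomm x
  exact Submodule.starProjection_eq_self_iff.1 hfix

end Generation

section Irreducible

theorem exists_eq_algebraMap_of_isStarNormal {A : Type*} [CStarAlgebra A] [Nontrivial A] {b : A}
    [IsStarNormal b]
    (h : ∀ f g : ℂ → ℂ, cfc f b * cfc g b = 0 → cfc f b = 0 ∨ cfc g b = 0) :
    ∃ c, b = algebraMap ℂ A c := by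
  -- Two distinct points of the spectrum are separated by functions with disjoint supports.
  let bump (r : ℝ) (w z : ℂ) : ℂ := (max 0 (r - dist z w) : ℝ)
  have continuous_bump (r : ℝ) (w : ℂ) : Continuous (bump r w) := by fun_prop
  have cfc_bump_ne_zero {r : ℝ} (hr : 0 < r) {w : ℂ} (hw : w ∈ spectrum ℂ b) :
      cfc (bump r w) b ≠ 0 := by
    rw [← cfc_const_zero ℂ b, Ne, cfc_eq_cfc_iff_eqOn (hf := (continuous_bump r w).continuousOn)
      (hg := continuousOn_const)]
    intro heq
    have h0 : ((max 0 (r - dist w w) : ℝ) : ℂ) = 0 := heq hw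
    rw [dist_self, sub_zero, Complex.ofReal_eq_zero] at h0
    exact hr.not_ge (max_eq_left_iff.1 h0)
  have bump_mul_bump (c d : ℂ) (z : ℂ) : bump (dist d c / 2) c z * bump (dist d c / 2) d z = 0 := by
    have htri := dist_triangle_left d c z
    simp only [bump, ← Complex.ofReal_mul, Complex.ofReal_eq_zero, mul_eq_zero, max_eq_left_iff]
    by_contra! hpos
    linarith
  obtain ⟨c, hc⟩ : (spectrum ℂ b).Nonempty := spectrum.nonempty b
  have eq_of_mem {d : ℂ} (hd : d ∈ spectrum ℂ b) : d = c := by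
    by_contra hdc
    have hr : 0 < dist d c / 2 := half_pos (dist_pos.2 hdc)
    refine (h (bump (dist d c / 2) c) (bump (dist d c / 2) d) ?_).elim
      (cfc_bump_ne_zero hr hc) (cfc_bump_ne_zero hr hd)
    rw [← cfc_mul _ _ b (continuous_bump _ c).continuousOn (continuous_bump _ d).continuousOn]
    simp only [bump_mul_bump, cfc_const_zero]
  refine ⟨c, ?_⟩
  rw [← cfc_const c b, ← cfc_congr fun z hz => eq_of_mem hz, cfc_id' ℂ b]

variable {A : Type*} [CStarAlgebra A]
  {H : Type u} [NormedAddCommGroup H] [InnerProductSpace ℂ H] [CompleteSpace H]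
  {π : A →⋆ₐ[ℂ] (H →L[ℂ] H)}

theorem IsIrreducibleRep.eq_zero_or_eq_zero_of_mul_eq_zero (hπ : IsIrreducibleRep π)
    {B C : H →L[ℂ] H} (hB : ∀ a, Commute B (π a)) (hBC : B * C = 0) : B = 0 ∨ C = 0 := by
  have hinv (a : A) (x : H) (hx : x ∈ B.ker) : π a x ∈ B.ker :=
    calc B (π a x) = π a (B x) := DFunLike.congr_fun (hB a).eq x
      _ = 0 := by rw [show B x = 0 from hx, map_zero]
  rcases hπ.2 B.ker B.isClosed_ker hinv with hker | hker
  · right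
    ext x
    have hx : C x ∈ B.ker := DFunLike.congr_fun hBC x
    rwa [hker, Submodule.mem_bot] at hx
  · left
    ext x
    exact (hker ▸ Submodule.mem_top : x ∈ B.ker)

/-- Schur's lemma for normal operators. -/
theorem IsIrreducibleRep.exists_eq_algebraMap (hπ : IsIrreducibleRep π) {B : H →L[ℂ] H}
    [IsStarNormal B] (hB : ∀ a, Commute B (π a)) : ∃ c, B = algebraMap ℂ (H →L[ℂ] H) c := by
  have : Nontrivial H := hπ.1
  have hB' (a : A) : Commute (star B) (π a) := by
    simpa only [map_star, star_star] using (hB (star a)).star_star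
  exact exists_eq_algebraMap_of_isStarNormal fun f g =>
    hπ.eq_zero_or_eq_zero_of_mul_eq_zero fun a => (hB a).cfc (hB' a) f

/-- The subspace `π(A)x`, whose density is the cyclicity of `x`. -/
noncomputable def orbitSubmodule (π : A →⋆ₐ[ℂ] (H →L[ℂ] H)) (x : H) : Submodule ℂ H :=
  LinearMap.range ((ContinuousLinearMap.apply ℂ H x).toLinearMap ∘ₗ (π : A →ₗ[ℂ] H →L[ℂ] H))

theorem isCyclicVector_iff {x : H} :
    IsCyclicVector π x ↔ (orbitSubmodule π x).topologicalClosure = ⊤ :=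
  Submodule.dense_iff_topologicalClosure_eq_top (s := orbitSubmodule π x)

theorem IsCyclicVector.eq_top {x : H} (hx : IsCyclicVector π x) {M : Submodule ℂ H}
    (hM : IsClosed (M : Set H)) (hinv : ∀ a, ∀ y ∈ M, π a y ∈ M) (hxM : x ∈ M) : M = ⊤ := by
  refine top_unique (isCyclicVector_iff.1 hx ▸ Submodule.topologicalClosure_minimal _ ?_ hM)
  rintro _ ⟨a, rfl⟩
  exact hinv a x hxM

theorem IsIrreducibleRep.isCyclicVector (hπ : IsIrreducibleRep π) {x : H} (hx : x ≠ 0) :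
    IsCyclicVector π x := by
  have hinv (a : A) (y : H) (hy : y ∈ (orbitSubmodule π x).topologicalClosure) :
      π a y ∈ (orbitSubmodule π x).topologicalClosure := by
    refine map_mem_closure (π a).continuous hy ?_
    rintro _ ⟨b, rfl⟩
    exact ⟨a * b, DFunLike.congr_fun (map_mul π a b) x⟩
  have hxmem : x ∈ (orbitSubmodule π x).topologicalClosure :=
    Submodule.le_topologicalClosure _ ⟨1, DFunLike.congr_fun (map_one π) x⟩
  refine isCyclicVector_iff.2 ((hπ.2 _ (Submodule.isClosed_topologicalClosure _) hinv).resolve_left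
    fun hbot => hx ?_)
  rwa [hbot, Submodule.mem_bot] at hxmem

theorem IsCyclicVector.isIrreducibleRep {x : H} (hx : IsCyclicVector π x) (hx0 : x ≠ 0)
    (hcomm : ∀ B : H →L[ℂ] H, (∀ a, Commute B (π a)) → B x ∈ ℂ ∙ x) : IsIrreducibleRep π := by
  refine ⟨⟨x, 0, hx0⟩, fun M hM hinv => ?_⟩
  have : CompleteSpace M := hM.completeSpace_coe
  have hMcomm (a : A) : Commute M.starProjection (π a) :=
    starProjection_comp_comm (hinv a) (map_star π a ▸ hinv (star a))
  obtain ⟨c, hc⟩ := Submodule.mem_span_singleton.1 (hcomm _ hMcomm)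
  by_cases hc0 : c = 0
  · left
    have hx_mem : x ∈ Mᗮ := by
      rw [← Submodule.starProjection_apply_eq_zero_iff, ← hc, hc0, zero_smul]
    have hinv' (a : A) (y : H) (hy : y ∈ Mᗮ) : π a y ∈ Mᗮ := by
      rw [← Submodule.starProjection_apply_eq_zero_iff] at hy ⊢
      rw [show M.starProjection (π a y) = π a (M.starProjection y) from
        DFunLike.congr_fun (hMcomm a).eq y, hy, map_zero]
    exact (Submodule.orthogonal_eq_top_iff M).1 (hx.eq_top M.isClosed_orthogonal hinv' hx_mem)
  · right
    have hx_mem : x ∈ M := (M.smul_mem_iff hc0).1 (hc ▸ M.starProjection_apply_mem x)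
    exact hx.eq_top hM hinv hx_mem

end Irreducible

/-! ### Operators permuting a Hilbert basis -/

section HilbertBasis

variable {ι κ : Type*} {H : Type u} [NormedAddCommGroup H] [InnerProductSpace ℂ H]
  {K : Type v} [NormedAddCommGroup K] [InnerProductSpace ℂ K]

theorem ext_inner_hilbertBasis (e : HilbertBasis ι ℂ H) {x y : H}
    (h : ∀ i, ⟪e i, x⟫_ℂ = ⟪e i, y⟫_ℂ) : x = y := by
  apply e.repr.injective
  ext i
  rw [e.repr_apply_apply, e.repr_apply_apply, h]

theorem ext_hilbertBasis (e : HilbertBasis ι ℂ H) {A B : H →L[ℂ] K}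
    (h : ∀ i, A (e i) = B (e i)) : A = B :=
  ContinuousLinearMap.ext_on (Submodule.dense_iff_topologicalClosure_eq_top.2 e.dense_span)
    (Set.forall_mem_range.2 h)

theorem exists_hilbertBasis_reindex [CompleteSpace K] (f : HilbertBasis κ ℂ K) (g : ι ≃ κ) :
    ∃ f' : HilbertBasis ι ℂ K, ∀ i, f' i = f (g i) :=
  ⟨HilbertBasis.mk (f.orthonormal.comp g g.injective) (by
    rw [g.surjective.range_comp, f.dense_span]), fun i => by rw [HilbertBasis.coe_mk]; rfl⟩

theorem exists_linearIsometryEquiv_apply_hilbertBasis [CompleteSpace K] (e : HilbertBasis ι ℂ H)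
    (f : HilbertBasis κ ℂ K) (g : ι ≃ κ) : ∃ V : H ≃ₗᵢ[ℂ] K, ∀ i, V (e i) = f (g i) := by
  classical
  obtain ⟨f', hf'⟩ := exists_hilbertBasis_reindex f g
  refine ⟨e.repr.trans f'.repr.symm, fun i => ?_⟩
  rw [← hf', LinearIsometryEquiv.trans_apply, e.repr_self, f'.repr_symm_single]

/-- The closed subspace of the vectors whose coordinates in the basis `e` vanish outside `Y`. -/
def supported (e : HilbertBasis ι ℂ H) (Y : Set ι) : Submodule ℂ H where
  carrier := {x | ∀ i ∉ Y, ⟪e i, x⟫_ℂ = 0}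
  add_mem' hx hy i hi := by rw [inner_add_right, hx i hi, hy i hi, add_zero]
  zero_mem' i _ := inner_zero_right (e i)
  smul_mem' c _ hx i hi := by rw [inner_smul_right, hx i hi, mul_zero]

variable {e : HilbertBasis ι ℂ H} {Y : Set ι}

theorem isClosed_supported (e : HilbertBasis ι ℂ H) (Y : Set ι) :
    IsClosed (supported e Y : Set H) := by
  change IsClosed {x : H | ∀ i ∉ Y, ⟪e i, x⟫_ℂ = 0}
  simp only [Set.ofPred_forall]
  exact isClosed_biInter fun i _ => isClosed_eq (by fun_prop) continuous_const

theorem hilbertBasis_mem_supported {i : ι} : e i ∈ supported e Y ↔ i ∈ Y := by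
  refine ⟨fun h => by_contra fun hi => e.orthonormal.ne_zero i ?_, fun hi j hj => ?_⟩
  · exact inner_self_eq_zero.1 (h i hi)
  · exact e.orthonormal.2 fun hji => hj (hji ▸ hi)

theorem supported_empty (e : HilbertBasis ι ℂ H) : supported e ∅ = ⊥ :=
  eq_bot_iff.2 fun _ hx => ext_inner_hilbertBasis e fun i =>
    (hx i (Set.notMem_empty i)).trans (inner_zero_right _).symm

theorem supported_singleton_le (e : HilbertBasis ι ℂ H) (i : ι) :
    supported e {i} ≤ ℂ ∙ e i := by
  intro x hx
  refine Submodule.mem_span_singleton.2 ⟨⟪e i, x⟫_ℂ, ext_inner_hilbertBasis e fun j => ?_⟩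
  rw [inner_smul_right]
  by_cases hj : j = i
  · rw [hj, inner_self_eq_norm_sq_to_K, e.orthonormal.1 i, RCLike.ofReal_one, one_pow, mul_one]
  · rw [e.orthonormal.2 hj, mul_zero, hx j hj]

theorem hilbertBasis_eq_of_mem_span_singleton {i j : ι} {z : H} (hi : e i ∈ ℂ ∙ z)
    (hj : e j ∈ ℂ ∙ z) : i = j := by
  obtain ⟨a, ha⟩ := Submodule.mem_span_singleton.1 hi
  obtain ⟨b, rfl⟩ : ∃ b, b • e j = z := by
    obtain ⟨b, hb⟩ := Submodule.mem_span_singleton.1 hj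
    have hb0 : b ≠ 0 := fun h => e.orthonormal.ne_zero j (by rw [← hb, h, zero_smul])
    exact ⟨b⁻¹, by rw [← hb, inv_smul_smul₀ hb0]⟩
  have hmem : e i ∈ supported e {j} := ha ▸ Submodule.smul_mem _ a
    (Submodule.smul_mem _ b (hilbertBasis_mem_supported.2 rfl))
  exact Set.mem_singleton_iff.1 (hilbertBasis_mem_supported.1 hmem)

/-- The operator `A` maps the basis `e` injectively into itself, through `A (e i) = e (f i)`. -/
structure MapsBasis (A : H →L[ℂ] H) (e : HilbertBasis ι ℂ H) (f : ι → ι) : Prop where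
  injective : Function.Injective f
  apply : ∀ i, A (e i) = e (f i)

theorem MapsBasis.one (e : HilbertBasis ι ℂ H) : MapsBasis 1 e id :=
  ⟨Function.injective_id, fun _ => rfl⟩

theorem MapsBasis.comp {A B : H →L[ℂ] H} {f g : ι → ι} (hA : MapsBasis A e f)
    (hB : MapsBasis B e g) : MapsBasis (A * B) e (f ∘ g) :=
  ⟨hA.injective.comp hB.injective, fun i =>
    (congrArg A (hB.apply i)).trans (hA.apply (g i))⟩

theorem MapsBasis.unique {A : H →L[ℂ] H} {f g : ι → ι} (hf : MapsBasis A e f)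
    (hg : MapsBasis A e g) : f = g :=
  funext fun i => e.orthonormal.linearIndependent.injective
    ((hf.apply i).symm.trans (hg.apply i))

variable [CompleteSpace H] [CompleteSpace K]

theorem linearIsometryEquiv_intertwines_star (V : H ≃ₗᵢ[ℂ] K) {A : H →L[ℂ] H} {B : K →L[ℂ] K}
    (h : ∀ x, V (A x) = B (V x)) (x : H) : V (star A x) = star B (V x) := by
  refine ext_inner_left ℂ (V.surjective.forall.2 fun y => ?_)
  calc ⟪V y, V (star A x)⟫_ℂ = ⟪V (A y), V x⟫_ℂ := by
        rw [V.inner_map_map, V.inner_map_map, ContinuousLinearMap.star_eq_adjoint,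
          ContinuousLinearMap.adjoint_inner_right]
    _ = ⟪V y, star B (V x)⟫_ℂ := by
        rw [h, ContinuousLinearMap.star_eq_adjoint, ContinuousLinearMap.adjoint_inner_right]

namespace MapsBasis

variable {A : H →L[ℂ] H} {f : ι → ι}

theorem inner_star_apply (h : MapsBasis A e f) (i : ι) (x : H) :
    ⟪e i, star A x⟫_ℂ = ⟪e (f i), x⟫_ℂ := by
  rw [ContinuousLinearMap.star_eq_adjoint, ContinuousLinearMap.adjoint_inner_right, h.apply]

theorem star_apply (h : MapsBasis A e f) (i : ι) : star A (e (f i)) = e i := by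
  classical
  refine ext_inner_hilbertBasis e fun j => ?_
  rw [h.inner_star_apply, orthonormal_iff_ite.1 e.orthonormal, orthonormal_iff_ite.1 e.orthonormal,
    h.injective.eq_iff]

theorem star_apply_eq_zero (h : MapsBasis A e f) {i : ι} (hi : i ∉ Set.range f) :
    star A (e i) = 0 := by
  refine ext_inner_hilbertBasis e fun j => ?_
  rw [h.inner_star_apply, inner_zero_right, e.orthonormal.2 fun hj => hi ⟨j, hj⟩]

theorem apply_mem_supported (h : MapsBasis A e f) (hY : ∀ i ∈ Y, f i ∈ Y) {x : H}
    (hx : x ∈ supported e Y) : A x ∈ supported e Y := fun j hj => by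
  rw [← ContinuousLinearMap.adjoint_inner_left, ← ContinuousLinearMap.star_eq_adjoint]
  by_cases hjf : j ∈ Set.range f
  · obtain ⟨i, rfl⟩ := hjf
    rw [h.star_apply, hx i fun hi => hj (hY i hi)]
  · rw [h.star_apply_eq_zero hjf, inner_zero_left]

theorem star_apply_mem_supported (h : MapsBasis A e f) (hY : ∀ i, f i ∈ Y → i ∈ Y) {x : H}
    (hx : x ∈ supported e Y) : star A x ∈ supported e Y := fun j hj =>
  (h.inner_star_apply j x).trans (hx (f j) fun hfj => hj (hY j hfj))

end MapsBasis

end HilbertBasis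

section ActsOnBasis

variable {P : ∀ (A : Type) [CStarAlgebra A], A → A → Prop} {ι κ : Type*}
  {H : Type u} [NormedAddCommGroup H] [InnerProductSpace ℂ H] [CompleteSpace H]
  {K : Type v} [NormedAddCommGroup K] [InnerProductSpace ℂ K] [CompleteSpace K]
  {π : UniversalCStar P →⋆ₐ[ℂ] (H →L[ℂ] H)} {π' : UniversalCStar P →⋆ₐ[ℂ] (K →L[ℂ] K)}

theorem linearIsometryEquiv_intertwines_of_generators (V : H ≃ₗᵢ[ℂ] K)
    (h₁ : ∀ x, V (π (UniversalCStar.fst P) x) = π' (UniversalCStar.fst P) (V x))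
    (h₂ : ∀ x, V (π (UniversalCStar.snd P) x) = π' (UniversalCStar.snd P) (V x))
    (a : UniversalCStar P) (x : H) : V (π a x) = π' a (V x) :=
  DFunLike.congr_fun (intertwines_of_generators (B := (V : H →L[ℂ] K))
    (ContinuousLinearMap.ext h₁) (ContinuousLinearMap.ext h₂)
    (ContinuousLinearMap.ext (linearIsometryEquiv_intertwines_star V h₁))
    (ContinuousLinearMap.ext (linearIsometryEquiv_intertwines_star V h₂)) a) x

/-- The two generators of a universal C⋆-algebra act on the basis `e` through the maps `s`
and `t` of its index set. This covers the permutative representations of both `𝒪₂` and `𝒬₂`. -/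
structure ActsOnBasis (π : UniversalCStar P →⋆ₐ[ℂ] (H →L[ℂ] H)) (e : HilbertBasis ι ℂ H)
    (s t : ι → ι) : Prop where
  fst : MapsBasis (π (UniversalCStar.fst P)) e s
  snd : MapsBasis (π (UniversalCStar.snd P)) e t

namespace ActsOnBasis

variable {e : HilbertBasis ι ℂ H} {f : HilbertBasis κ ℂ K} {s t : ι → ι} {s' t' : κ → κ}

theorem apply_mem_supported (h : ActsOnBasis π e s t) {Y : Set ι} (hs : ∀ i, s i ∈ Y ↔ i ∈ Y)
    (ht : ∀ i, t i ∈ Y ↔ i ∈ Y) (a : UniversalCStar P) (x : H) (hx : x ∈ supported e Y) :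
    π a x ∈ supported e Y :=
  apply_mem_of_generators (isClosed_supported e Y)
    (fun _ => h.fst.apply_mem_supported fun i => (hs i).2)
    (fun _ => h.snd.apply_mem_supported fun i => (ht i).2)
    (fun _ => h.fst.star_apply_mem_supported fun i => (hs i).1)
    (fun _ => h.snd.star_apply_mem_supported fun i => (ht i).1) a hx

theorem eq_univ_of_isCyclicVector (h : ActsOnBasis π e s t) {i : ι}
    (hi : IsCyclicVector π (e i)) {Y : Set ι} (hs : ∀ j, s j ∈ Y ↔ j ∈ Y)
    (ht : ∀ j, t j ∈ Y ↔ j ∈ Y) (hiY : i ∈ Y) : Y = Set.univ := by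
  have htop := hi.eq_top (isClosed_supported e Y) (h.apply_mem_supported hs ht)
    (hilbertBasis_mem_supported.2 hiY)
  exact Set.eq_univ_of_forall fun j => hilbertBasis_mem_supported.1 (htop ▸ Submodule.mem_top)

theorem exists_intertwiner (h : ActsOnBasis π e s t) (h' : ActsOnBasis π' f s' t') (g : ι ≃ κ)
    (hs : Function.Semiconj g s s') (ht : Function.Semiconj g t t') :
    ∃ V : H ≃ₗᵢ[ℂ] K, (∀ i, V (e i) = f (g i)) ∧ ∀ a x, V (π a x) = π' a (V x) := by
  obtain ⟨V, hV⟩ := exists_linearIsometryEquiv_apply_hilbertBasis e f g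
  have intertwines {A : H →L[ℂ] H} {B : K →L[ℂ] K} {p : ι → ι} {q : κ → κ}
      (hA : MapsBasis A e p) (hB : MapsBasis B f q) (hpq : Function.Semiconj g p q) (x : H) :
      V (A x) = B (V x) := by
    have hcomp : (V : H →L[ℂ] K) ∘L A = B ∘L (V : H →L[ℂ] K) := ext_hilbertBasis e fun i =>
      calc V (A (e i)) = f (g (p i)) := by rw [hA.apply, hV]
        _ = B (V (e i)) := by rw [hV, hB.apply, hpq.eq]
    exact DFunLike.congr_fun hcomp x
  exact ⟨V, hV, linearIsometryEquiv_intertwines_of_generators V (intertwines h.fst h'.fst hs)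
    (intertwines h.snd h'.snd ht)⟩

theorem unitarilyEquivalent (h : ActsOnBasis π e s t) (h' : ActsOnBasis π' f s' t') (g : ι ≃ κ)
    (hs : Function.Semiconj g s s') (ht : Function.Semiconj g t t') :
    UnitarilyEquivalent π π' :=
  (h.exists_intertwiner h' g hs ht).imp fun _ hV => hV.2

theorem eq_self_of_commute (h : ActsOnBasis π e s t) (hπ : IsIrreducibleRep π)
    (φ : Equiv.Perm ι) (hs : Function.Commute φ s) (ht : Function.Commute φ t) (i : ι) :
    φ i = i := by
  obtain ⟨V, hV, hcomm⟩ := h.exists_intertwiner h φ hs ht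
  have : IsStarNormal (V : H →L[ℂ] H) :=
    isStarNormal_of_mem_unitary (Unitary.linearIsometryEquiv.symm V).2
  obtain ⟨c, hc⟩ := hπ.exists_eq_algebraMap (B := (V : H →L[ℂ] H)) fun a =>
    ContinuousLinearMap.ext (hcomm a)
  have hci : e (φ i) = c • e i :=
    (hV i).symm.trans (DFunLike.congr_fun (hc.trans (Algebra.algebraMap_eq_smul_one c)) (e i))
  exact hilbertBasis_eq_of_mem_span_singleton
    (Submodule.mem_span_singleton.2 ⟨c, hci.symm⟩) (Submodule.mem_span_singleton_self (e i))

end ActsOnBasis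

end ActsOnBasis

/-! ### The shift of a branching function system -/

section Combinatorics

/-- The sequence `s` satisfies `s (j + d) = s j` for large `j`. -/
def EventuallyPeriodic {α : Type*} (d : ℕ) (s : ℕ → α) : Prop :=
  ∀ᶠ j in Filter.atTop, s (j + d) = s j

theorem eventuallyPeriodic_shift_iff {α : Type*} {d : ℕ} {s : ℕ → α} (k : ℕ) :
    EventuallyPeriodic d (fun j => s (j + k)) ↔ EventuallyPeriodic d s := by
  conv_rhs => rw [EventuallyPeriodic, ← Filter.map_add_atTop_eq_nat k, Filter.eventually_map]
  simp only [EventuallyPeriodic, add_right_comm]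

namespace IsBranching

variable {σ : Letter → ℕ → ℕ} (h : IsBranching σ)

theorem codingMap_eq_of_isCode {n : ℕ} {s : ℕ → Letter} (hs : IsCode σ n s) :
    codingMap h n = s :=
  (existsUnique_isCode h n).unique (isCode_codingMap h n) hs

theorem codingMap_apply_zero (i : Letter) (n : ℕ) : codingMap h (σ i n) 0 = i :=
  ((isCode_iff h).1 (isCode_codingMap h (σ i n))).1

theorem codingMap_apply_succ (i : Letter) (n k : ℕ) :
    codingMap h (σ i n) (k + 1) = codingMap h n k :=
  (congrFun (h.codingMap_eq_of_isCode
    ((isCode_iff h).1 (isCode_codingMap h (σ i n))).2) k).symm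

/-- The shift `T`: the only `m` with `n = σ i m` for some `i`. -/
noncomputable def pred (n : ℕ) : ℕ := (h.exists_eq n).choose.2

theorem apply_pred (n : ℕ) : σ (codingMap h n 0) (h.pred n) = n := by
  have hn : σ (h.exists_eq n).choose.1 (h.pred n) = n := (h.exists_eq n).choose_spec
  have h0 := h.codingMap_apply_zero (h.exists_eq n).choose.1 (h.pred n)
  rw [hn] at h0
  rw [h0, hn]

theorem pred_apply (i : Letter) (n : ℕ) : h.pred (σ i n) = n :=
  (h.eq_of_eq (h.apply_pred (σ i n))).2

theorem codingMap_pred (n k : ℕ) : codingMap h (h.pred n) k = codingMap h n (k + 1) := by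
  rw [← h.codingMap_apply_succ (codingMap h n 0), h.apply_pred]

theorem codingMap_iterate_pred (n j k : ℕ) :
    codingMap h (h.pred^[j] n) k = codingMap h n (k + j) := by
  induction j generalizing n with
  | zero => rfl
  | succ j ih => rw [Function.iterate_succ_apply, ih, codingMap_pred, add_assoc]

theorem induction_of_codingMap_ne {p : ℕ → Prop} {i : Letter}
    (apply_of_ne : ∀ j ≠ i, ∀ m, p (σ j m)) (apply_self : ∀ m, p m → p (σ i m)) {n : ℕ}
    (hn : codingMap h n ≠ fun _ => i) : p n := by
  obtain ⟨k, hk⟩ := Function.ne_iff.1 hn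
  clear hn
  induction k generalizing n with
  | zero => exact h.apply_pred n ▸ apply_of_ne _ hk _
  | succ k ih =>
    by_cases h0 : codingMap h n 0 = i
    · exact h.apply_pred n ▸ h0 ▸ apply_self _ (ih (h.codingMap_pred n k ▸ hk))
    · exact h.apply_pred n ▸ apply_of_ne _ h0 _

theorem apply_eq_self_of_codingMap_eq (hinj : Function.Injective (codingMap h)) {i : Letter}
    {m : ℕ} (hm : codingMap h m = fun _ => i) : σ i m = m := by
  refine hinj (funext fun k => ?_)
  cases k with
  | zero => rw [codingMap_apply_zero, hm]
  | succ k => rw [codingMap_apply_succ, hm]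

theorem eq_of_iterate_pred_eq {x y : ℕ} (hxy : codingMap h x = codingMap h y) {k : ℕ}
    (hk : h.pred^[k] x = h.pred^[k] y) : x = y := by
  induction k with
  | zero => exact hk
  | succ k ih =>
    refine ih ?_
    calc h.pred^[k] x = σ (codingMap h (h.pred^[k] x) 0) (h.pred (h.pred^[k] x)) :=
          (h.apply_pred _).symm
      _ = σ (codingMap h (h.pred^[k] y) 0) (h.pred (h.pred^[k] y)) := by
          rw [codingMap_iterate_pred, codingMap_iterate_pred, hxy,
            ← Function.iterate_succ_apply' h.pred, hk, Function.iterate_succ_apply']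
      _ = h.pred^[k] y := h.apply_pred _

theorem exists_iterate_pred_eq {x z k : ℕ} (hz : codingMap h z = codingMap h (h.pred^[k] x)) :
    ∃ y, codingMap h y = codingMap h x ∧ h.pred^[k] y = z := by
  induction k generalizing x with
  | zero => exact ⟨z, hz, rfl⟩
  | succ k ih =>
    obtain ⟨y, hy, hyz⟩ := ih (x := h.pred x) hz
    refine ⟨σ (codingMap h x 0) y, funext fun j => ?_, ?_⟩
    · cases j with
      | zero => rw [codingMap_apply_zero]
      | succ j => rw [codingMap_apply_succ, hy, codingMap_pred]
    · rw [Function.iterate_succ_apply, pred_apply, hyz]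

theorem iterate_pred_congr {x y k l : ℕ} (hxy : h.pred^[k] x = h.pred^[l] y) (j : ℕ) :
    h.pred^[j + k] x = h.pred^[j + l] y := by
  rw [Function.iterate_add_apply, hxy, ← Function.iterate_add_apply]

/-- The forward orbits of `x` and `y` under the shift meet. -/
def TailEquivalent (x y : ℕ) : Prop := ∃ a b, h.pred^[a] x = h.pred^[b] y

theorem tailEquivalent_apply_iff (i : Letter) (x y : ℕ) :
    h.TailEquivalent (σ i x) y ↔ h.TailEquivalent x y := by
  constructor
  · rintro ⟨a, b, hab⟩
    refine ⟨a, 1 + b, ?_⟩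
    rw [← h.iterate_pred_congr hab, add_comm, Function.iterate_succ_apply, h.pred_apply]
  · rintro ⟨a, b, hab⟩
    exact ⟨a + 1, b, by rwa [Function.iterate_succ_apply, h.pred_apply]⟩

variable {h} in
theorem TailEquivalent.eventuallyPeriodic_iff {x y : ℕ} (hxy : h.TailEquivalent x y) (d : ℕ) :
    EventuallyPeriodic d (codingMap h x) ↔ EventuallyPeriodic d (codingMap h y) := by
  obtain ⟨a, b, hab⟩ := hxy
  rw [← eventuallyPeriodic_shift_iff a, ← eventuallyPeriodic_shift_iff (s := codingMap h y) b]
  simp only [← codingMap_iterate_pred, hab]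

/-- The points `x` and `y` have the same code, and `T^k y = T^(k+d) x` for large `k`, where `T` is
the shift. Where it is everywhere defined, this relation is the graph of a permutation commuting
with `σ₁` and `σ₂`. -/
def Translate (d x y : ℕ) : Prop :=
  codingMap h y = codingMap h x ∧ ∃ k, h.pred^[k] y = h.pred^[k + d] x

variable {h} in
theorem Translate.right_unique {d x y y' : ℕ} (hy : h.Translate d x y) (hy' : h.Translate d x y') :
    y = y' := by
  obtain ⟨hc, k, hk⟩ := hy
  obtain ⟨hc', l, hl⟩ := hy'
  refine h.eq_of_iterate_pred_eq (hc.trans hc'.symm) (k := l + k) ?_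
  rw [h.iterate_pred_congr hk, add_comm l k, h.iterate_pred_congr hl, add_left_comm]

variable {h} in
theorem Translate.left_unique {d x x' y : ℕ} (hx : h.Translate d x y) (hx' : h.Translate d x' y) :
    x = x' := by
  obtain ⟨hc, k, hk⟩ := hx
  obtain ⟨hc', l, hl⟩ := hx'
  refine h.eq_of_iterate_pred_eq (hc.symm.trans hc') (k := l + (k + d)) ?_
  rw [← h.iterate_pred_congr hk, add_left_comm, ← h.iterate_pred_congr hl, add_comm]

variable {h} in
theorem Translate.apply {d x y : ℕ} (hy : h.Translate d x y) (i : Letter) :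
    h.Translate d (σ i x) (σ i y) := by
  obtain ⟨hc, k, hk⟩ := hy
  refine ⟨funext fun j => ?_, k + 1, ?_⟩
  · cases j with
    | zero => rw [codingMap_apply_zero, codingMap_apply_zero]
    | succ j => rw [codingMap_apply_succ, codingMap_apply_succ, hc]
  · rw [add_right_comm, Function.iterate_succ_apply, Function.iterate_succ_apply, pred_apply,
      pred_apply, hk]

variable {h} in
theorem Translate.eventuallyPeriodic {d x y : ℕ} (hy : h.Translate d x y) :
    EventuallyPeriodic d (codingMap h x) := by
  obtain ⟨hc, k, hk⟩ := hy
  refine Filter.eventually_atTop.2 ⟨k, fun j hj => ?_⟩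
  obtain ⟨j, rfl⟩ := Nat.exists_eq_add_of_le' hj
  rw [add_assoc, ← codingMap_iterate_pred, ← hk, codingMap_iterate_pred, hc]

theorem exists_perm_translate {d : ℕ} (hd : ∀ n, EventuallyPeriodic d (codingMap h n)) :
    ∃ φ : Equiv.Perm ℕ, ∀ x, h.Translate d x (φ x) := by
  have codingMap_add (x : ℕ) :
      ∃ k, codingMap h (h.pred^[k + d] x) = codingMap h (h.pred^[k] x) := by
    obtain ⟨k, hk⟩ := Filter.eventually_atTop.1 (hd x)
    refine ⟨k, funext fun j => ?_⟩
    rw [codingMap_iterate_pred, codingMap_iterate_pred, ← add_assoc, hk _ (Nat.le_add_left k j)]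
  have exists_right (x : ℕ) : ∃ y, h.Translate d x y := by
    obtain ⟨k, hk⟩ := codingMap_add x
    obtain ⟨y, hy, hyk⟩ := h.exists_iterate_pred_eq hk
    exact ⟨y, hy, k, hyk⟩
  have exists_left (y : ℕ) : ∃ x, h.Translate d x y := by
    obtain ⟨k, hk⟩ := codingMap_add y
    obtain ⟨x, hx, hxk⟩ := h.exists_iterate_pred_eq hk.symm
    exact ⟨x, hx.symm, k, hxk.symm⟩
  choose f hf using exists_right
  choose g hg using exists_left
  exact ⟨⟨f, g, fun x => (hg (f x)).left_unique (hf x),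
    fun y => (hf (g y)).right_unique (hg y)⟩, hf⟩

theorem iterate_pred_wordMap (w : List Letter) (n : ℕ) :
    h.pred^[w.length] (wordMap σ w n) = n := by
  induction w with
  | nil => rfl
  | cons i w ih =>
    calc h.pred^[w.length] (h.pred (σ i (wordMap σ w n))) = n := by rw [pred_apply, ih]

theorem wordMap_prefixWord_codingMap (n k : ℕ) :
    wordMap σ (prefixWord (codingMap h n) k) (h.pred^[k] n) = n := by
  obtain ⟨m, hm⟩ := isCode_codingMap h n k
  have hpred := h.iterate_pred_wordMap (prefixWord (codingMap h n) k) m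
  rw [hm, prefixWord, List.length_ofFn] at hpred
  rw [hpred, hm]

theorem isPeriodicPt_of_wordMap_eq {v w : List Letter} {n : ℕ}
    (hvw : wordMap σ v n = wordMap σ w n) (hle : v.length ≤ w.length) :
    Function.IsPeriodicPt h.pred (w.length - v.length) n := by
  have hw := h.iterate_pred_wordMap w n
  rwa [← hvw, ← Nat.sub_add_cancel hle, Function.iterate_add_apply, h.iterate_pred_wordMap] at hw

end IsBranching

end Combinatorics

/-! ### Permutative representations of the Cuntz algebra -/

section CuntzAlgebra

theorem O2.word_cons (i : Letter) (w : List Letter) :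
    O2.word (i :: w) = O2.gen i * O2.word w :=
  List.prod_cons

variable {H : Type u} [NormedAddCommGroup H] [InnerProductSpace ℂ H] [CompleteSpace H]
  {K : Type v} [NormedAddCommGroup K] [InnerProductSpace ℂ K] [CompleteSpace K]
  {π : O2 →⋆ₐ[ℂ] (H →L[ℂ] H)} {π' : O2 →⋆ₐ[ℂ] (K →L[ℂ] K)}

/-- The vector `x` lies in the range of `S_w` for every initial piece `w` of the sequence `s`.
This extends to arbitrary vectors, without reference to a basis, the relation between an index
and its code. -/
def HasCode (π : O2 →⋆ₐ[ℂ] (H →L[ℂ] H)) (x : H) (s : ℕ → Letter) : Prop :=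
  ∀ k, x ∈ Set.range (π (O2.word (prefixWord s k)))

theorem HasCode.map {x : H} {s : ℕ → Letter} (hx : HasCode π x s) {V : H → K}
    (hV : ∀ a y, V (π a y) = π' a (V y)) : HasCode π' (V x) s := fun k => by
  obtain ⟨y, hy⟩ := hx k
  exact ⟨V y, by rw [← hV, hy]⟩

theorem hasCode_of_gen_apply_eq {x : H} {i : Letter} (hx : π (O2.gen i) x = x) :
    HasCode π x fun _ => i := fun k => by
  refine ⟨x, ?_⟩
  induction k with
  | zero => rw [prefixWord, List.ofFn_zero, O2.word, List.map_nil, List.prod_nil, map_one]; rfl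
  | succ k ih =>
    rw [prefixWord_succ, O2.word_cons, map_mul]
    exact (congrArg (π (O2.gen i)) ih).trans hx

namespace IsPermutationBasis

variable {e f : HilbertBasis ℕ ℂ H} {σ σ' : Letter → ℕ → ℕ}

theorem mapsBasis_gen (hb : IsPermutationBasis π e σ) (i : Letter) :
    MapsBasis (π (O2.gen i)) e (σ i) :=
  ⟨hb.branching.injective i, hb.map_basis i⟩

theorem of_mapsBasis (h : ∀ i, MapsBasis (π (O2.gen i)) e (σ i)) :
    IsPermutationBasis π e σ := by
  have hsum (x : H) : π (O2.gen Letter.one) (star (π (O2.gen Letter.one)) x) +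
      π (O2.gen Letter.two) (star (π (O2.gen Letter.two)) x) = x := by
    have hrel := DFunLike.congr_fun (congrArg π O2.isCuntzPair.2.2) x
    simp only [map_add, map_mul, map_star, map_one] at hrel
    exact hrel
  refine ⟨⟨fun i => (h i).injective, Set.disjoint_left.2 ?_, Set.eq_univ_of_forall fun n => ?_⟩,
    fun i => (h i).apply⟩
  · rintro n ⟨a, rfl⟩ ⟨b, hb⟩
    have hsum_n := hsum (e (σ Letter.one a))
    rw [(h _).star_apply, (h _).apply, ← hb, (h _).star_apply, (h _).apply] at hsum_n
    exact e.orthonormal.ne_zero _ (add_eq_left.1 hsum_n)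
  · by_contra hn
    rw [Set.mem_union, not_or] at hn
    have hsum_n := hsum (e n)
    rw [(h _).star_apply_eq_zero hn.1, (h _).star_apply_eq_zero hn.2, map_zero, map_zero,
      add_zero] at hsum_n
    exact e.orthonormal.ne_zero n hsum_n.symm

theorem mapsBasis_word (hb : IsPermutationBasis π e σ) (w : List Letter) :
    MapsBasis (π (O2.word w)) e (wordMap σ w) := by
  induction w with
  | nil =>
    rw [O2.word, List.map_nil, List.prod_nil, map_one]
    exact MapsBasis.one e
  | cons i w ih =>
    rw [O2.word_cons, map_mul]
    exact (hb.mapsBasis_gen i).comp ih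

theorem actsOnBasis (hb : IsPermutationBasis π e σ) :
    ActsOnBasis π e (σ Letter.one) (σ Letter.two) :=
  ⟨hb.mapsBasis_gen Letter.one, hb.mapsBasis_gen Letter.two⟩

theorem hasCode (hb : IsPermutationBasis π e σ) (n : ℕ) :
    HasCode π (e n) (codingMap hb.branching n) := fun k =>
  ⟨e (hb.branching.pred^[k] n), by
    rw [(hb.mapsBasis_word _).apply, hb.branching.wordMap_prefixWord_codingMap]⟩

theorem mem_supported_of_hasCode (hb : IsPermutationBasis π e σ) {x : H} {s : ℕ → Letter}
    (hx : HasCode π x s) : x ∈ supported e {n | codingMap hb.branching n = s} := by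
  intro n hn
  obtain ⟨k, hk⟩ : ∃ k, n ∉ Set.range (wordMap σ (prefixWord s k)) :=
    not_forall.1 fun hcode => hn (hb.branching.codingMap_eq_of_isCode hcode)
  obtain ⟨y, rfl⟩ := hx k
  rw [← ContinuousLinearMap.adjoint_inner_left, ← ContinuousLinearMap.star_eq_adjoint,
    (hb.mapsBasis_word _).star_apply_eq_zero hk, inner_zero_left]

theorem exists_codingMap_eq (hb : IsPermutationBasis π e σ) {x : H} (hx0 : x ≠ 0)
    {s : ℕ → Letter} (hx : HasCode π x s) : ∃ n, codingMap hb.branching n = s := by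
  by_contra! hne
  have hmem := hb.mem_supported_of_hasCode hx
  rw [Set.eq_empty_of_forall_notMem (s := {n | codingMap hb.branching n = s}) hne,
    supported_empty] at hmem
  exact hx0 hmem

theorem injective_codingMap (hb : IsPermutationBasis π e σ)
    (hinj : Function.Injective (codingMap hb.branching)) (hb' : IsPermutationBasis π f σ') :
    Function.Injective (codingMap hb'.branching) := by
  intro x y hxy
  obtain ⟨n, hn⟩ := hb.exists_codingMap_eq (f.orthonormal.ne_zero x) (hb'.hasCode x)
  have hfiber : {m | codingMap hb.branching m = codingMap hb'.branching x} = {n} :=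
    Set.ext fun m => by rw [← hn]; exact hinj.eq_iff
  have mem_line {z : ℕ} (hz : codingMap hb'.branching z = codingMap hb'.branching x) :
      f z ∈ ℂ ∙ e n :=
    supported_singleton_le e n (hfiber ▸ hb.mem_supported_of_hasCode (hz ▸ hb'.hasCode z))
  exact hilbertBasis_eq_of_mem_span_singleton (mem_line rfl) (mem_line hxy.symm)

theorem tailEquivalent (hb : IsPermutationBasis π e σ) (hπ : IsIrreducibleRep π) (x y : ℕ) :
    hb.branching.TailEquivalent x y :=
  Set.eq_univ_iff_forall.1 (hb.actsOnBasis.eq_univ_of_isCyclicVector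
    (hπ.isCyclicVector (e.orthonormal.ne_zero y)) (Y := {z | hb.branching.TailEquivalent z y})
    (fun z => hb.branching.tailEquivalent_apply_iff _ z y)
    (fun z => hb.branching.tailEquivalent_apply_iff _ z y) ⟨0, 0, rfl⟩) x

theorem eq_of_translate (hb : IsPermutationBasis π e σ) (hπ : IsIrreducibleRep π) {d x y : ℕ}
    (hxy : hb.branching.Translate d x y) : y = x := by
  obtain ⟨φ, hφ⟩ := hb.branching.exists_perm_translate fun n =>
    ((hb.tailEquivalent hπ n x).eventuallyPeriodic_iff d).2 hxy.eventuallyPeriodic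
  have hcomm (i : Letter) : Function.Commute φ (σ i) := fun n =>
    (hφ (σ i n)).right_unique ((hφ n).apply i)
  have hid : φ x = x :=
    hb.actsOnBasis.eq_self_of_commute hπ φ (hcomm Letter.one) (hcomm Letter.two) x
  exact (hxy.right_unique (hφ x)).trans hid

theorem injective_codingMap_of_isIrreducibleRep (hb : IsPermutationBasis π e σ)
    (hπ : IsIrreducibleRep π) : Function.Injective (codingMap hb.branching) := by
  intro x y hxy
  obtain ⟨a, b, hab⟩ := hb.tailEquivalent hπ x y
  rcases le_total a b with hle | hle
  · refine hb.eq_of_translate hπ (d := b - a) ⟨hxy, a, ?_⟩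
    rw [hab, Nat.add_sub_cancel' hle]
  · refine (hb.eq_of_translate hπ (d := a - b) ⟨hxy.symm, b, ?_⟩).symm
    rw [← hab, Nat.add_sub_cancel' hle]

end IsPermutationBasis

end CuntzAlgebra

section TypeP

open Function (IsPeriodicPt minimalPeriod periodicPts)

variable {H : Type u} [NormedAddCommGroup H] [InnerProductSpace ℂ H] [CompleteSpace H]
  {π : O2 →⋆ₐ[ℂ] (H →L[ℂ] H)} {e : HilbertBasis ℕ ℂ H} {σ : Letter → ℕ → ℕ}

namespace IsPermutationBasis

theorem star_word_apply (hb : IsPermutationBasis π e σ) (n k : ℕ) :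
    π (star (O2.word (prefixWord (codingMap hb.branching n) k))) (e n) =
      e (hb.branching.pred^[k] n) := by
  have hstar := (hb.mapsBasis_word (prefixWord (codingMap hb.branching n) k)).star_apply
    (hb.branching.pred^[k] n)
  rwa [hb.branching.wordMap_prefixWord_codingMap, ← map_star] at hstar

theorem isTypePVector_infinite (hb : IsPermutationBasis π e σ) {n : ℕ}
    (hn : Function.Injective fun k => hb.branching.pred^[k] n) :
    IsTypePVector π (e n) (MultiIndex.infinite (codingMap hb.branching n)) := by
  change Orthonormal ℂ _
  simp only [hb.star_word_apply]
  exact e.orthonormal.comp _ hn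

theorem exists_isTypePVector_finite (hb : IsPermutationBasis π e σ) {n : ℕ}
    (hn : n ∈ periodicPts hb.branching.pred) : ∃ I, IsTypePVector π (e n) I := by
  have h := hb.branching
  set w := prefixWord (codingMap h n) (minimalPeriod h.pred n) with hw
  have hlen : w.length = minimalPeriod h.pred n := List.length_ofFn
  have hpos : 0 < w.length := hlen ▸ Function.minimalPeriod_pos_of_mem_periodicPts hn
  have wordMap_take_ne {i j : ℕ} (hij : i < j) (hj : j < w.length) :
      wordMap σ (w.take i) n ≠ wordMap σ (w.take j) n := fun heq => by
    have hper := h.isPeriodicPt_of_wordMap_eq heq (by simp only [List.length_take]; omega)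
    have hzero := hper.eq_zero_of_lt_minimalPeriod (by simp only [List.length_take]; omega)
    simp only [List.length_take] at hzero
    omega
  refine ⟨MultiIndex.finite w (List.length_pos_iff.1 hpos), ?_, ?_⟩
  · calc π (O2.word w) (e n) = e (wordMap σ w (h.pred^[minimalPeriod h.pred n] n)) := by
          rw [(hb.mapsBasis_word w).apply, Function.iterate_minimalPeriod]
      _ = e n := by rw [hw, h.wordMap_prefixWord_codingMap]
  · simp only [(hb.mapsBasis_word _).apply]
    refine e.orthonormal.comp _ fun i j hij => ?_
    rcases lt_trichotomy i j with hlt | heq | hlt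
    · exact (wordMap_take_ne hlt j.2 hij).elim
    · exact heq
    · exact (wordMap_take_ne hlt i.2 hij.symm).elim

theorem exists_isTypeP (hb : IsPermutationBasis π e σ) (hπ : IsIrreducibleRep π) :
    ∃ I, IsTypeP π I := by
  have hcyc (n : ℕ) : IsCyclicVector π (e n) := hπ.isCyclicVector (e.orthonormal.ne_zero n)
  by_cases hper : ∃ n, n ∈ periodicPts hb.branching.pred
  · obtain ⟨n, hn⟩ := hper
    obtain ⟨I, hI⟩ := hb.exists_isTypePVector_finite hn
    exact ⟨I, e, σ, hb, n, hcyc n, hI⟩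
  · have iterate_ne {i j : ℕ} (hij : i < j) : hb.branching.pred^[i] 0 ≠ hb.branching.pred^[j] 0 :=
      fun heq => hper ⟨hb.branching.pred^[i] 0, j - i, Nat.sub_pos_of_lt hij, by
        rw [IsPeriodicPt, Function.IsFixedPt, ← Function.iterate_add_apply,
          Nat.sub_add_cancel hij.le, heq]⟩
    refine ⟨_, e, σ, hb, 0, hcyc 0, hb.isTypePVector_infinite fun i j hij => ?_⟩
    rcases lt_trichotomy i j with hlt | heq | hlt
    · exact (iterate_ne hlt hij).elim
    · exact heq
    · exact (iterate_ne hlt hij.symm).elim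

theorem eq_singleton_of_isTypePVector_finite (hb : IsPermutationBasis π e σ) {n m a : ℕ}
    {i : Letter} (hm : σ i m = m) (hnm : hb.branching.pred^[a] n = m) {w : List Letter}
    {hw : w ≠ []} (hn : IsTypePVector π (e n) (MultiIndex.finite w hw)) : w = [i] := by
  have h := hb.branching
  have hfix : h.pred m = m := by conv_lhs => rw [← hm, h.pred_apply]
  have basis_injective : Function.Injective e := e.orthonormal.linearIndependent.injective
  have hwn : wordMap σ w n = n :=
    basis_injective (((hb.mapsBasis_word w).apply n).symm.trans hn.1)
  have hper : IsPeriodicPt h.pred w.length n :=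
    h.isPeriodicPt_of_wordMap_eq (v := []) hwn.symm (Nat.zero_le _)
  obtain rfl : n = m := by
    have hle : a ≤ a * w.length := Nat.le_mul_of_pos_right a (List.length_pos_iff.2 hw)
    calc n = h.pred^[a * w.length - a + a] n := by
          rw [Nat.sub_add_cancel hle]; exact (hper.const_mul a).symm
      _ = m := by rw [Function.iterate_add_apply, hnm, Function.iterate_fixed hfix]
  rcases w with _ | ⟨j, _ | ⟨k, w⟩⟩
  · exact (hw rfl).elim
  · rw [(h.eq_of_eq (hwn.trans hm.symm)).1]
  · obtain rfl : j = i := (h.eq_of_eq (hwn.trans hm.symm)).1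
    have heq : π (O2.word []) (e n) = π (O2.word [j]) (e n) := by
      rw [(hb.mapsBasis_word []).apply, (hb.mapsBasis_word [j]).apply]
      exact congrArg e hm.symm
    have hzero_one := hn.2.linearIndependent.injective
      (a₁ := ⟨0, Nat.zero_lt_succ _⟩) (a₂ := ⟨1, Nat.succ_lt_succ (Nat.zero_lt_succ _)⟩) heq
    exact absurd (Fin.ext_iff.1 hzero_one) Nat.zero_ne_one

theorem not_isTypePVector_infinite (hb : IsPermutationBasis π e σ) {n a : ℕ}
    (ha : hb.branching.pred (hb.branching.pred^[a] n) = hb.branching.pred^[a] n)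
    (s : ℕ → Letter) : ¬ IsTypePVector π (e n) (MultiIndex.infinite s) := fun hn => by
  have horth : Orthonormal ℂ fun k : ℕ => π (star (O2.word (prefixWord s k))) (e n) := hn
  obtain rfl : codingMap hb.branching n = s := by
    refine hb.branching.codingMap_eq_of_isCode fun k => by_contra fun hk => horth.ne_zero k ?_
    rw [map_star, (hb.mapsBasis_word _).star_apply_eq_zero hk]
  have heq : a = a + 1 := by
    apply horth.linearIndependent.injective
    simp only [hb.star_word_apply, Function.iterate_succ_apply', ha]
  exact absurd heq (Nat.succ_ne_self a).symm

theorem eq_single_of_isTypePVector (hb : IsPermutationBasis π e σ) (hπ : IsIrreducibleRep π)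
    {I : MultiIndex} {n : ℕ} (hn : IsTypePVector π (e n) I) {i : Letter} {m : ℕ}
    (hm : codingMap hb.branching m = fun _ => i) : I = MultiIndex.single i := by
  have h := hb.branching
  have hσm : σ i m = m :=
    h.apply_eq_self_of_codingMap_eq (hb.injective_codingMap_of_isIrreducibleRep hπ) hm
  have hfix : h.pred m = m := by conv_lhs => rw [← hσm, h.pred_apply]
  obtain ⟨a, b, hab⟩ := hb.tailEquivalent hπ n m
  rw [Function.iterate_fixed hfix] at hab
  cases I with
  | finite w hw =>
    obtain rfl := hb.eq_singleton_of_isTypePVector_finite hσm hab hn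
    rfl
  | infinite s => exact (hb.not_isTypePVector_infinite (by rw [hab, hfix]) s hn).elim

end IsPermutationBasis

end TypeP

/-! ### The odometer -/

section Odometer

/-- The bijection `τ` satisfies `τ ∘ σ₂ = σ₁` and `τ ∘ σ₁ = σ₂ ∘ τ`. On codes, this is the addition
of `1` to a dyadic integer, the letters `2` and `1` standing for the digits `0` and `1`. -/
structure IsOdometer (σ : Letter → ℕ → ℕ) (τ : Equiv.Perm ℕ) : Prop where
  apply_two : ∀ n, τ (σ Letter.two n) = σ Letter.one n
  apply_one : ∀ n, τ (σ Letter.one n) = σ Letter.two (τ n)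

variable {σ : Letter → ℕ → ℕ} {τ : Equiv.Perm ℕ}

namespace IsBranching

variable (h : IsBranching σ) {i j : Letter}

theorem codingMap_pred_eq_const {n : ℕ} (hn : codingMap h n = fun _ => i) :
    codingMap h (h.pred n) = fun _ => i :=
  funext fun k => by rw [codingMap_pred, hn]

theorem apply_pred_of_codingMap_eq_const {n : ℕ} (hn : codingMap h n = fun _ => i) :
    σ i (h.pred n) = n := by
  conv_rhs => rw [← h.apply_pred n, hn]

theorem translate_one_pred {n : ℕ} (hn : codingMap h n = fun _ => i) :
    h.Translate 1 n (h.pred n) :=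
  ⟨(h.codingMap_pred_eq_const hn).trans hn.symm, 0, rfl⟩

include h in
theorem injective_iterate (hij : i ≠ j) :
    Function.Injective fun p : ℕ × ℕ => (σ i)^[p.1] (σ j p.2) := by
  rintro ⟨k, m⟩ ⟨l, m'⟩ hkl
  dsimp only at hkl
  induction k generalizing l with
  | zero =>
    cases l with
    | zero => rw [h.injective j hkl]
    | succ l =>
      rw [Function.iterate_succ_apply'] at hkl
      exact (hij (h.eq_of_eq hkl).1.symm).elim
  | succ k ih =>
    cases l with
    | zero =>
      rw [Function.iterate_succ_apply'] at hkl
      exact (hij (h.eq_of_eq hkl).1).elim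
    | succ l =>
      rw [Function.iterate_succ_apply', Function.iterate_succ_apply'] at hkl
      obtain ⟨rfl, rfl⟩ := Prod.mk.inj (ih l (h.injective i hkl))
      rfl

theorem surjective_iterate (hij : i ≠ j) (hcode : ∀ n, codingMap h n ≠ fun _ => i) :
    Function.Surjective fun p : ℕ × ℕ => (σ i)^[p.1] (σ j p.2) := by
  intro n
  refine h.induction_of_codingMap_ne (i := i)
    (p := fun n => ∃ p : ℕ × ℕ, (σ i)^[p.1] (σ j p.2) = n) ?_ ?_ (hcode n)
  · intro j' hj' m
    obtain rfl : j' = j := by cases i <;> cases j <;> cases j' <;> trivial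
    exact ⟨(0, m), rfl⟩
  · rintro _ ⟨⟨k, m⟩, rfl⟩
    exact ⟨(k + 1, m), Function.iterate_succ_apply' _ _ _⟩

theorem exists_isOdometer (hcode : ∀ i n, codingMap h n ≠ fun _ => i) :
    ∃ τ : Equiv.Perm ℕ, IsOdometer σ τ := by
  let F : ℕ × ℕ ≃ ℕ := Equiv.ofBijective (fun p => (σ Letter.one)^[p.1] (σ Letter.two p.2))
    ⟨h.injective_iterate (by simp), h.surjective_iterate (by simp) (hcode _)⟩
  let G : ℕ × ℕ ≃ ℕ := Equiv.ofBijective (fun p => (σ Letter.two)^[p.1] (σ Letter.one p.2))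
    ⟨h.injective_iterate (by simp), h.surjective_iterate (by simp) (hcode _)⟩
  have apply_F (p : ℕ × ℕ) : F.symm.trans G (F p) = G p := congrArg G (F.symm_apply_apply p)
  refine ⟨F.symm.trans G, fun n => apply_F (0, n), fun n => ?_⟩
  obtain ⟨⟨k, m⟩, rfl⟩ := F.surjective n
  calc F.symm.trans G (σ Letter.one (F (k, m)))
      = F.symm.trans G (F (k + 1, m)) := congrArg _ (Function.iterate_succ_apply' _ _ _).symm
    _ = G (k + 1, m) := apply_F _
    _ = σ Letter.two (G (k, m)) := Function.iterate_succ_apply' _ _ _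
    _ = σ Letter.two (F.symm.trans G (F (k, m))) := by rw [apply_F]

end IsBranching

namespace IsOdometer

section Codes

variable (hτ : IsOdometer σ τ) (h : IsBranching σ)
include hτ

theorem pred_apply {n : ℕ} (hn : codingMap h n = fun _ => Letter.one) :
    h.pred (τ n) = τ (h.pred n) := by
  conv_lhs => rw [← h.apply_pred_of_codingMap_eq_const hn, hτ.apply_one, h.pred_apply]

theorem codingMap_apply {n : ℕ} (hn : codingMap h n = fun _ => Letter.one) :
    codingMap h (τ n) = fun _ => Letter.two := by
  funext k
  induction k generalizing n with
  | zero => rw [← h.apply_pred_of_codingMap_eq_const hn, hτ.apply_one, h.codingMap_apply_zero]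
  | succ k ih => rw [← h.codingMap_pred, hτ.pred_apply h hn, ih (h.codingMap_pred_eq_const hn)]

theorem tailEquivalent_apply {n : ℕ} (hn : codingMap h n ≠ fun _ => Letter.one) :
    h.TailEquivalent (τ n) n := by
  refine h.induction_of_codingMap_ne (p := fun n => h.TailEquivalent (τ n) n) ?_ ?_ hn
  · rintro (_ | _) hj m
    · exact (hj rfl).elim
    · refine ⟨1, 1, ?_⟩
      rw [hτ.apply_two, Function.iterate_one, h.pred_apply, h.pred_apply]
  · rintro m ⟨a, b, hab⟩
    refine ⟨a + 1, b + 1, ?_⟩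
    rw [hτ.apply_one, Function.iterate_succ_apply, h.pred_apply, hab, Function.iterate_succ_apply,
      h.pred_apply]

theorem eventuallyPeriodic_one_apply_iff (n : ℕ) :
    EventuallyPeriodic 1 (codingMap h (τ n)) ↔ EventuallyPeriodic 1 (codingMap h n) := by
  by_cases hn : codingMap h n = fun _ => Letter.one
  · rw [hn, hτ.codingMap_apply h hn]
    exact iff_of_true (.of_forall fun _ => rfl) (.of_forall fun _ => rfl)
  · exact (hτ.tailEquivalent_apply h hn).eventuallyPeriodic_iff 1

theorem apply_apply_of_commute {φ : ℕ → ℕ} (hφ : ∀ i, Function.Commute φ (σ i)) {n : ℕ}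
    (hn : codingMap h n ≠ fun _ => Letter.one) : φ (τ n) = τ (φ n) := by
  refine h.induction_of_codingMap_ne (p := fun n => φ (τ n) = τ (φ n)) ?_ ?_ hn
  · rintro (_ | _) hj m
    · exact (hj rfl).elim
    · rw [hτ.apply_two, (hφ _).eq, (hφ _).eq, hτ.apply_two]
  · intro m hm
    rw [hτ.apply_one, (hφ _).eq, (hφ _).eq, hτ.apply_one, hm]

theorem commute_of_translate_one {φ : ℕ → ℕ} (hφ : ∀ n, h.Translate 1 n (φ n)) :
    Function.Commute φ τ := by
  intro n
  by_cases hn : codingMap h n = fun _ => Letter.one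
  · calc φ (τ n) = h.pred (τ n) :=
          (hφ _).right_unique (h.translate_one_pred (hτ.codingMap_apply h hn))
      _ = τ (h.pred n) := hτ.pred_apply h hn
      _ = τ (φ n) := by rw [(h.translate_one_pred hn).right_unique (hφ n)]
  · exact hτ.apply_apply_of_commute h
      (fun i n => (hφ (σ i n)).right_unique ((hφ n).apply i)) hn

end Codes

section FixedPoint

variable (hτ : IsOdometer σ τ) {m : ℕ} (hm : σ Letter.two m = m)
include hτ

theorem apply_two_zpow (k : ℤ) (n : ℕ) :
    σ Letter.two ((τ ^ k) n) = (τ ^ (2 * k)) (σ Letter.two n) := by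
  have apply_two_apply (n : ℕ) : σ Letter.two (τ n) = (τ ^ (2 : ℤ)) (σ Letter.two n) := by
    rw [← hτ.apply_one, ← hτ.apply_two]; rfl
  induction k generalizing n with
  | zero => rfl
  | succ k ih =>
    rw [zpow_add_one, mul_add_one, zpow_add, Equiv.Perm.mul_apply, Equiv.Perm.mul_apply, ih,
      apply_two_apply]
  | pred k ih =>
    obtain ⟨x, rfl⟩ := τ.surjective n
    rw [apply_two_apply, ← Equiv.Perm.mul_apply, ← Equiv.Perm.mul_apply, ← zpow_add_one,
      sub_add_cancel, ← zpow_add, mul_sub_one, sub_add_cancel, ih]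

include hm

theorem zpow_two_mul_apply (k : ℤ) : (τ ^ (2 * k)) m = σ Letter.two ((τ ^ k) m) := by
  rw [hτ.apply_two_zpow, hm]

theorem zpow_two_mul_add_one_apply (k : ℤ) :
    (τ ^ (2 * k + 1)) m = σ Letter.one ((τ ^ k) m) := by
  rw [add_comm, zpow_one_add, Equiv.Perm.mul_apply, hτ.zpow_two_mul_apply hm,
    hτ.apply_two]

theorem injective_codingMap_zpow (h : IsBranching σ) :
    Function.Injective fun k : ℤ => codingMap h ((τ ^ k) m) := by
  intro k l hkl
  dsimp only at hkl
  induction hd : (k - l).natAbs using Nat.strong_induction_on generalizing k l with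
  | _ d ih =>
    have tail_eq {i : Letter} {x y : ℕ} (hxy : codingMap h (σ i x) = codingMap h (σ i y)) :
        codingMap h x = codingMap h y :=
      funext fun j => by rw [← h.codingMap_apply_succ i, hxy, h.codingMap_apply_succ]
    have eq_of_half {a b : ℤ} (hab : codingMap h ((τ ^ a) m) = codingMap h ((τ ^ b) m))
        (hlt : a ≠ b → (a - b).natAbs < d) : a = b :=
      by_contra fun hne => hne (ih _ (hlt hne) hab rfl)
    have head_ne {x y : ℕ} :
        codingMap h (σ Letter.one x) ≠ codingMap h (σ Letter.two y) := fun hxy => by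
      have h0 := congrFun hxy 0
      rw [h.codingMap_apply_zero, h.codingMap_apply_zero] at h0
      cases h0
    rcases Int.even_or_odd' k with ⟨a, rfl | rfl⟩ <;> rcases Int.even_or_odd' l with ⟨b, rfl | rfl⟩
    all_goals simp only [hτ.zpow_two_mul_apply hm, hτ.zpow_two_mul_add_one_apply hm] at hkl
    · rw [eq_of_half (tail_eq hkl) (by omega)]
    · exact (head_ne hkl.symm).elim
    · exact (head_ne hkl).elim
    · rw [eq_of_half (tail_eq hkl) (by omega)]

theorem sameCycle_apply_two_iff (h : IsBranching σ) (n : ℕ) :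
    τ.SameCycle m (σ Letter.two n) ↔ τ.SameCycle m n := by
  constructor
  · rintro ⟨k, hk⟩
    rcases Int.even_or_odd' k with ⟨a, rfl | rfl⟩
    · rw [hτ.zpow_two_mul_apply hm] at hk
      exact ⟨a, (h.eq_of_eq hk).2⟩
    · rw [hτ.zpow_two_mul_add_one_apply hm] at hk
      cases (h.eq_of_eq hk).1
  · rintro ⟨k, rfl⟩
    exact ⟨2 * k, hτ.zpow_two_mul_apply hm k⟩

end FixedPoint

end IsOdometer

end Odometer

/-! ### Representations of the `2`-adic ring C⋆-algebra -/

section Restriction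

variable {H : Type u} [NormedAddCommGroup H] [InnerProductSpace ℂ H] [CompleteSpace H]

theorem restrict_gen_two (ρ : Q2 →⋆ₐ[ℂ] (H →L[ℂ] H)) :
    restrict ρ (O2.gen Letter.two) = ρ Q2.S₂ :=
  congrArg ρ embed_S₂

theorem restrict_gen_one (ρ : Q2 →⋆ₐ[ℂ] (H →L[ℂ] H)) :
    restrict ρ (O2.gen Letter.one) = ρ Q2.U * restrict ρ (O2.gen Letter.two) := by
  rw [restrict_gen_two, ← map_mul]
  exact congrArg ρ embed_S₁

theorem mul_restrict_gen_one (ρ : Q2 →⋆ₐ[ℂ] (H →L[ℂ] H)) :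
    ρ Q2.U * restrict ρ (O2.gen Letter.one) = restrict ρ (O2.gen Letter.two) * ρ Q2.U := by
  rw [restrict_gen_one, restrict_gen_two, ← map_mul ρ Q2.S₂, Q2.isTwoAdicPair.2.2.2.1, map_mul,
    map_pow, pow_two, mul_assoc]

theorem apply_U_mem_unitary (ρ : Q2 →⋆ₐ[ℂ] (H →L[ℂ] H)) : ρ Q2.U ∈ unitary (H →L[ℂ] H) :=
  Unitary.map_mem ρ ⟨Q2.isTwoAdicPair.1, Q2.isTwoAdicPair.2.1⟩

theorem restrict_gen_one_apply (ρ : Q2 →⋆ₐ[ℂ] (H →L[ℂ] H)) (x : H) :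
    restrict ρ (O2.gen Letter.one) x = ρ Q2.U (restrict ρ (O2.gen Letter.two) x) :=
  DFunLike.congr_fun (restrict_gen_one ρ) x

theorem apply_restrict_gen_one (ρ : Q2 →⋆ₐ[ℂ] (H →L[ℂ] H)) (x : H) :
    ρ Q2.U (restrict ρ (O2.gen Letter.one) x) = restrict ρ (O2.gen Letter.two) (ρ Q2.U x) :=
  DFunLike.congr_fun (mul_restrict_gen_one ρ) x

end Restriction

section CanonicalRep

theorem mapsBasis_canonicalU : MapsBasis canonicalU basisZ (· + 1) :=
  ⟨add_left_injective 1, canonicalU_apply⟩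

theorem mapsBasis_canonicalS₂ : MapsBasis canonicalS₂ basisZ (2 * ·) :=
  ⟨mul_right_injective₀ two_ne_zero, canonicalS₂_apply⟩

theorem actsOnBasis_canonicalRep : ActsOnBasis canonicalRep basisZ (· + 1) (2 * ·) :=
  ⟨canonicalRep_U.symm ▸ mapsBasis_canonicalU, canonicalRep_S₂.symm ▸ mapsBasis_canonicalS₂⟩

theorem isPermutativeQ2_canonicalRep : IsPermutativeQ2 canonicalRep := by
  let g : ℕ ≃ ℤ := Equiv.intEquivNat.symm
  obtain ⟨e, he⟩ := exists_hilbertBasis_reindex basisZ g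
  refine ⟨e, fun n => g.symm (2 * g n), fun n => g.symm (g n + 1), ?_, ?_, fun n => ⟨?_, ?_⟩⟩
  · exact g.symm.injective.comp ((mul_right_injective₀ two_ne_zero).comp g.injective)
  · exact (g.trans ((Equiv.addRight 1).trans g.symm)).bijective
  · rw [canonicalRep_S₂, he, he, canonicalS₂_apply, Equiv.apply_symm_apply]
  · rw [canonicalRep_U, he, he, canonicalU_apply, Equiv.apply_symm_apply]

theorem exists_canonicalRep_apply_eq (k : ℤ) :
    ∃ a, canonicalRep a (basisZ 0) = basisZ k := by
  induction k with
  | zero => exact ⟨1, DFunLike.congr_fun (map_one canonicalRep) (basisZ 0)⟩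
  | succ k ih =>
    obtain ⟨a, ha⟩ := ih
    refine ⟨Q2.U * a, ?_⟩
    rw [map_mul, canonicalRep_U, mul_apply_eq_comp, ha, canonicalU_apply]
  | pred k ih =>
    obtain ⟨a, ha⟩ := ih
    refine ⟨star Q2.U * a, ?_⟩
    rw [map_mul, map_star, canonicalRep_U, mul_apply_eq_comp, ha,
      star_canonicalU_apply]

theorem isCyclicVector_basisZ_zero : IsCyclicVector canonicalRep (basisZ 0) :=
  isCyclicVector_iff.2 <| top_unique <| basisZ.dense_span ▸ Submodule.topologicalClosure_mono
    (Submodule.span_le.2 (Set.range_subset_iff.2 exists_canonicalRep_apply_eq))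

theorem mem_span_basisZ_zero_of_canonicalS₂_apply_eq {x : ell2Z} (hx : canonicalS₂ x = x) :
    x ∈ ℂ ∙ basisZ 0 := by
  refine supported_singleton_le basisZ 0 fun k (hk : k ≠ 0) => ?_
  induction hd : k.natAbs using Nat.strong_induction_on generalizing k with
  | _ d ih =>
    rw [← hx, ← ContinuousLinearMap.adjoint_inner_left, ← ContinuousLinearMap.star_eq_adjoint]
    rcases Int.even_or_odd' k with ⟨j, rfl | rfl⟩
    · rw [star_canonicalS₂_even]
      exact ih j.natAbs (by omega) j (by omega) rfl
    · rw [star_canonicalS₂_odd, inner_zero_left]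

theorem isIrreducibleRep_canonicalRep : IsIrreducibleRep canonicalRep := by
  refine isCyclicVector_basisZ_zero.isIrreducibleRep (basisZ.orthonormal.ne_zero 0)
    fun B hB => mem_span_basisZ_zero_of_canonicalS₂_apply_eq ?_
  have hcomm := DFunLike.congr_fun (hB Q2.S₂).eq (basisZ 0)
  rw [canonicalRep_S₂] at hcomm
  calc canonicalS₂ (B (basisZ 0)) = B (canonicalS₂ (basisZ 0)) := hcomm.symm
    _ = B (basisZ 0) := by rw [canonicalS₂_apply, mul_zero]

theorem not_isIrreducibleRep_restrict_canonicalRep :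
    ¬ IsIrreducibleRep (restrict canonicalRep) := by
  intro hirr
  have hacts : ActsOnBasis (restrict canonicalRep) basisZ ((· + 1) ∘ (2 * ·)) (2 * ·) :=
    ⟨restrict_gen_one canonicalRep ▸ restrict_gen_two canonicalRep ▸
      actsOnBasis_canonicalRep.fst.comp actsOnBasis_canonicalRep.snd,
    restrict_gen_two canonicalRep ▸ actsOnBasis_canonicalRep.snd⟩
  have huniv : {k : ℤ | 0 ≤ k} = Set.univ :=
    hacts.eq_univ_of_isCyclicVector (hirr.isCyclicVector (basisZ.orthonormal.ne_zero 0))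
      (fun j => by simp only [Function.comp_apply, Set.mem_ofPred_eq]; omega)
      (fun j => by simp only [Set.mem_ofPred_eq]; omega) (le_refl (0 : ℤ))
  exact absurd (Set.eq_univ_iff_forall.1 huniv (-1)) (by decide)

end CanonicalRep

section TwoAdicRingAlgebra

variable {H : Type u} [NormedAddCommGroup H] [InnerProductSpace ℂ H] [CompleteSpace H]
  {K : Type v} [NormedAddCommGroup K] [InnerProductSpace ℂ K] [CompleteSpace K]
  {ρ : Q2 →⋆ₐ[ℂ] (H →L[ℂ] H)} {ρ' : Q2 →⋆ₐ[ℂ] (K →L[ℂ] K)}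

section Intertwiner

variable {e : HilbertBasis ℕ ℂ H} {σ : Letter → ℕ → ℕ}

theorem intertwines_U_of_intertwines_restrict (hb : IsPermutationBasis (restrict ρ) e σ)
    (hcode : ∀ n, codingMap hb.branching n ≠ fun _ => Letter.one) {B : H →L[ℂ] K}
    (hB : ∀ a, B ∘L restrict ρ a = restrict ρ' a ∘L B) : B ∘L ρ Q2.U = ρ' Q2.U ∘L B := by
  have hgen (i : Letter) (x : H) :
      B (restrict ρ (O2.gen i) x) = restrict ρ' (O2.gen i) (B x) :=
    DFunLike.congr_fun (hB (O2.gen i)) x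
  refine ext_hilbertBasis e fun n => ?_
  refine hb.branching.induction_of_codingMap_ne
    (p := fun n => B (ρ Q2.U (e n)) = ρ' Q2.U (B (e n))) ?_ ?_ (hcode n)
  · rintro (_ | _) hj m
    · exact (hj rfl).elim
    · rw [← hb.map_basis, ← restrict_gen_one_apply, hgen, hgen, restrict_gen_one_apply]
  · intro m hm
    rw [← hb.map_basis, apply_restrict_gen_one, hgen, hgen, hm, apply_restrict_gen_one]

theorem comp_star_eq_of_comp_eq {u : H →L[ℂ] H} {v : K →L[ℂ] K} (hu : u ∈ unitary (H →L[ℂ] H))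
    (hv : v ∈ unitary (K →L[ℂ] K)) {B : H →L[ℂ] K} (h : B ∘L u = v ∘L B) :
    B ∘L star u = star v ∘L B :=
  calc B ∘L star u = (star v * v) ∘L (B ∘L star u) := by
        rw [Unitary.star_mul_self_of_mem hv]; rfl
    _ = star v ∘L ((v ∘L B) ∘L star u) := rfl
    _ = (star v ∘L B) ∘L (u * star u) := by rw [← h]; rfl
    _ = star v ∘L B := by rw [Unitary.mul_star_self_of_mem hu]; rfl

theorem intertwines_of_intertwines_restrict (hb : IsPermutationBasis (restrict ρ) e σ)
    (hcode : ∀ n, codingMap hb.branching n ≠ fun _ => Letter.one) {B : H →L[ℂ] K}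
    (hB : ∀ a, B ∘L restrict ρ a = restrict ρ' a ∘L B) (a : Q2) : B ∘L ρ a = ρ' a ∘L B := by
  have hU := intertwines_U_of_intertwines_restrict hb hcode hB
  have hS₂ := hB (O2.gen Letter.two)
  have hS₂' := hB (star (O2.gen Letter.two))
  rw [restrict_gen_two, restrict_gen_two] at hS₂
  rw [map_star, map_star, restrict_gen_two, restrict_gen_two] at hS₂'
  exact intertwines_of_generators hU hS₂
    (comp_star_eq_of_comp_eq (apply_U_mem_unitary ρ) (apply_U_mem_unitary ρ') hU) hS₂' a

theorem eq_of_restrict_eq {ρ ρ' : Q2 →⋆ₐ[ℂ] (H →L[ℂ] H)}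
    (hb : IsPermutationBasis (restrict ρ) e σ)
    (hcode : ∀ n, codingMap hb.branching n ≠ fun _ => Letter.one)
    (h : restrict ρ' = restrict ρ) : ρ' = ρ :=
  DFunLike.ext _ _ fun a =>
    (intertwines_of_intertwines_restrict (B := .id ℂ H) hb hcode (fun _ => by rw [h]; rfl) a).symm

theorem isIrreducibleRep_of_restrict (h : IsIrreducibleRep (restrict ρ)) : IsIrreducibleRep ρ :=
  ⟨h.1, fun M hM hinv => h.2 M hM fun a => hinv (embed a)⟩

theorem isIrreducibleRep_restrict (hρ : IsIrreducibleRep ρ)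
    (hb : IsPermutationBasis (restrict ρ) e σ)
    (hcode : ∀ n, codingMap hb.branching n ≠ fun _ => Letter.one) :
    IsIrreducibleRep (restrict ρ) := by
  refine ⟨hρ.1, fun M hM hinv => hρ.2 M hM fun a x hx => ?_⟩
  have : CompleteSpace M := hM.completeSpace_coe
  have hcomm := intertwines_of_intertwines_restrict (ρ' := ρ) (B := M.starProjection) hb hcode
    (fun a => starProjection_comp_comm (hinv a) (map_star (restrict ρ) a ▸ hinv (star a))) a
  have hfix : M.starProjection (ρ a x) = ρ a x := by
    simpa only [ContinuousLinearMap.comp_apply, Submodule.starProjection_eq_self_iff.2 hx]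
      using DFunLike.congr_fun hcomm x
  exact Submodule.starProjection_eq_self_iff.1 hfix

end Intertwiner

/-- The generators `S₂` and `U` of `𝒬₂` act on the basis `e` through the maps `σ₂` and `τ`; the
system `σ` consists of `σ₁ = τ ∘ σ₂` and `σ₂`, through which the restriction to `𝒪₂` acts. -/
structure IsPermutationBasisQ2 (ρ : Q2 →⋆ₐ[ℂ] (H →L[ℂ] H)) (e : HilbertBasis ℕ ℂ H)
    (σ : Letter → ℕ → ℕ) (τ : Equiv.Perm ℕ) : Prop extends
    IsPermutationBasis (restrict ρ) e σ where
  map_U : ∀ n, ρ Q2.U (e n) = e (τ n)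

theorem IsPermutativeQ2.exists_basis (h : IsPermutativeQ2 ρ) :
    ∃ e σ τ, IsPermutationBasisQ2 ρ e σ τ := by
  obtain ⟨e, σ₂, τ, hσ₂, hτ, hmap⟩ := h
  have hU : MapsBasis (ρ Q2.U) e τ := ⟨hτ.injective, fun n => (hmap n).2⟩
  have hS₂ : MapsBasis (restrict ρ (O2.gen Letter.two)) e σ₂ :=
    restrict_gen_two ρ ▸ ⟨hσ₂, fun n => (hmap n).1⟩
  let σ : Letter → ℕ → ℕ
    | Letter.one => τ ∘ σ₂
    | Letter.two => σ₂
  have hgen (i : Letter) : MapsBasis (restrict ρ (O2.gen i)) e (σ i) := by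
    cases i with
    | one => exact restrict_gen_one ρ ▸ hU.comp hS₂
    | two => exact hS₂
  exact ⟨e, σ, Equiv.ofBijective τ hτ, IsPermutationBasis.of_mapsBasis hgen, hU.apply⟩

namespace IsPermutationBasisQ2

variable {e : HilbertBasis ℕ ℂ H} {σ : Letter → ℕ → ℕ} {τ : Equiv.Perm ℕ}

theorem isPermutativeQ2 (hb : IsPermutationBasisQ2 ρ e σ τ) : IsPermutativeQ2 ρ :=
  ⟨e, σ Letter.two, τ, hb.branching.injective _, τ.bijective, fun n =>
    ⟨restrict_gen_two ρ ▸ hb.map_basis Letter.two n, hb.map_U n⟩⟩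

theorem actsOnBasis (hb : IsPermutationBasisQ2 ρ e σ τ) : ActsOnBasis ρ e τ (σ Letter.two) :=
  ⟨⟨τ.injective, hb.map_U⟩, restrict_gen_two ρ ▸ hb.mapsBasis_gen Letter.two⟩

theorem isOdometer (hb : IsPermutationBasisQ2 ρ e σ τ) : IsOdometer σ τ := by
  have hU : MapsBasis (ρ Q2.U) e τ := hb.actsOnBasis.fst
  have hone := hb.mapsBasis_gen Letter.one
  have htwo := hb.mapsBasis_gen Letter.two
  exact ⟨congrFun ((restrict_gen_one ρ ▸ hU.comp htwo).unique hone),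
    congrFun ((mul_restrict_gen_one ρ ▸ hU.comp hone).unique (htwo.comp hU))⟩

section Irreducible

theorem eventuallyPeriodic_one (hb : IsPermutationBasisQ2 ρ e σ τ) (hρ : IsIrreducibleRep ρ)
    {n : ℕ} (hn : codingMap hb.branching n = fun _ => Letter.one) (m : ℕ) :
    EventuallyPeriodic 1 (codingMap hb.branching m) :=
  Set.eq_univ_iff_forall.1 (hb.actsOnBasis.eq_univ_of_isCyclicVector
    (hρ.isCyclicVector (e.orthonormal.ne_zero n))
    (Y := {m | EventuallyPeriodic 1 (codingMap hb.branching m)})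
    (hb.isOdometer.eventuallyPeriodic_one_apply_iff hb.branching)
    (fun m =>
      ((hb.branching.tailEquivalent_apply_iff _ m m).2 ⟨0, 0, rfl⟩).eventuallyPeriodic_iff 1)
    (hb.branching.translate_one_pred hn).eventuallyPeriodic) m

theorem exists_apply_two_eq_self (hb : IsPermutationBasisQ2 ρ e σ τ) (hρ : IsIrreducibleRep ρ)
    {n : ℕ} (hn : codingMap hb.branching n = fun _ => Letter.one) :
    ∃ m, σ Letter.two m = m := by
  have hm := hb.isOdometer.codingMap_apply hb.branching hn
  obtain ⟨φ, hφ⟩ := hb.branching.exists_perm_translate (hb.eventuallyPeriodic_one hρ hn)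
  have hid : φ (τ n) = τ n := hb.actsOnBasis.eq_self_of_commute hρ φ
    (hb.isOdometer.commute_of_translate_one hb.branching hφ)
    (fun k => (hφ (σ Letter.two k)).right_unique ((hφ k).apply Letter.two)) (τ n)
  have hpred : hb.branching.pred (τ n) = τ n :=
    ((hb.branching.translate_one_pred hm).right_unique (hφ (τ n))).trans hid
  refine ⟨τ n, ?_⟩
  conv_lhs => rw [← hpred]
  exact hb.branching.apply_pred_of_codingMap_eq_const hm

theorem sameCycle (hb : IsPermutationBasisQ2 ρ e σ τ) (hρ : IsIrreducibleRep ρ) {m : ℕ}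
    (hm : σ Letter.two m = m) (n : ℕ) : τ.SameCycle m n :=
  Set.eq_univ_iff_forall.1 (hb.actsOnBasis.eq_univ_of_isCyclicVector
    (hρ.isCyclicVector (e.orthonormal.ne_zero m)) (Y := {n | τ.SameCycle m n})
    (fun _ => Equiv.Perm.sameCycle_apply_right)
    (hb.isOdometer.sameCycle_apply_two_iff hm hb.branching) (Equiv.Perm.SameCycle.refl τ m)) n

theorem injective_codingMap_of_apply_two_eq_self (hb : IsPermutationBasisQ2 ρ e σ τ)
    (hρ : IsIrreducibleRep ρ) {m : ℕ} (hm : σ Letter.two m = m) :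
    Function.Injective (codingMap hb.branching) :=
  (hb.isOdometer.injective_codingMap_zpow hm hb.branching).of_comp_right (hb.sameCycle hρ hm)

theorem unitarilyEquivalent_canonicalRep (hb : IsPermutationBasisQ2 ρ e σ τ)
    (hρ : IsIrreducibleRep ρ) {m : ℕ} (hm : σ Letter.two m = m) :
    UnitarilyEquivalent ρ canonicalRep := by
  have hinj : Function.Injective fun k : ℤ => (τ ^ k) m := fun k l hkl =>
    hb.isOdometer.injective_codingMap_zpow hm hb.branching (congrArg (codingMap _) hkl)
  let g : ℤ ≃ ℕ := Equiv.ofBijective (fun k : ℤ => (τ ^ k) m) ⟨hinj, hb.sameCycle hρ hm⟩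
  have hU : Function.Semiconj g (· + 1) τ := fun k => by
    change (τ ^ (k + 1)) m = τ ((τ ^ k) m)
    rw [add_comm, zpow_one_add, Equiv.Perm.mul_apply]
  have hS₂ : Function.Semiconj g (2 * ·) (σ Letter.two) := hb.isOdometer.zpow_two_mul_apply hm
  exact hb.actsOnBasis.unitarilyEquivalent actsOnBasis_canonicalRep g.symm
    (hU.inverse_left g.left_inv g.right_inv) (hS₂.inverse_left g.left_inv g.right_inv)

end Irreducible

end IsPermutationBasisQ2

end TwoAdicRingAlgebra

section Classification

theorem isTwoAdicPair_of_isCuntzPair {A : Type*} [CStarAlgebra A] {s₁ s₂ u : A}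
    (hs : IsCuntzPair s₁ s₂) (hu : u ∈ unitary A) (h₂ : u * s₂ = s₁) (h₁ : u * s₁ = s₂ * u) :
    IsTwoAdicPair u s₂ := by
  refine ⟨hu.1, hu.2, hs.2.1, ?_, ?_⟩
  · rw [← h₁, ← h₂, pow_two, mul_assoc]
  · rw [mul_assoc, ← star_mul, h₂, add_comm]
    exact hs.2.2

variable {H : Type u} [NormedAddCommGroup H] [InnerProductSpace ℂ H] [CompleteSpace H]
  {K : Type v} [NormedAddCommGroup K] [InnerProductSpace ℂ K] [CompleteSpace K]
  {π : O2 →⋆ₐ[ℂ] (H →L[ℂ] H)} {ρ : Q2 →⋆ₐ[ℂ] (H →L[ℂ] H)} {ρ' : Q2 →⋆ₐ[ℂ] (K →L[ℂ] K)}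
  {e : HilbertBasis ℕ ℂ H} {σ : Letter → ℕ → ℕ}

theorem exists_restrict_eq {u : H →L[ℂ] H} (hu : u ∈ unitary (H →L[ℂ] H))
    (htwo : u * π (O2.gen Letter.two) = π (O2.gen Letter.one))
    (hone : u * π (O2.gen Letter.one) = π (O2.gen Letter.two) * u) :
    ∃ ρ : Q2 →⋆ₐ[ℂ] (H →L[ℂ] H), restrict ρ = π ∧ ρ Q2.U = u := by
  have hcuntz : IsCuntzPair (π O2.S₁) (π O2.S₂) := by
    simpa only [IsCuntzPair, map_mul, map_star, map_add, map_one] using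
      And.imp (congrArg π) (And.imp (congrArg π) (congrArg π)) O2.isCuntzPair
  obtain ⟨ρ, ⟨hU, hS₂⟩, -⟩ :=
    Q2.existsUnique_lift _ _ (isTwoAdicPair_of_isCuntzPair hcuntz hu htwo hone)
  refine ⟨ρ, (O2.existsUnique_lift _ _ hcuntz).unique ⟨?_, ?_⟩ ⟨rfl, rfl⟩, hU⟩
  · calc ρ (embed O2.S₁) = ρ Q2.U * ρ Q2.S₂ := by rw [embed_S₁, map_mul]
      _ = π O2.S₁ := by rw [hU, hS₂]; exact htwo
  · exact (congrArg ρ embed_S₂).trans hS₂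

theorem IsOdometer.exists_isPermutationBasisQ2 {τ : Equiv.Perm ℕ} (hτ : IsOdometer σ τ)
    (hb : IsPermutationBasis π e σ) :
    ∃ ρ, restrict ρ = π ∧ IsPermutationBasisQ2 ρ e σ τ := by
  obtain ⟨V, hV⟩ := exists_linearIsometryEquiv_apply_hilbertBasis e e τ
  have htwo : (V : H →L[ℂ] H) * π (O2.gen Letter.two) = π (O2.gen Letter.one) :=
    ext_hilbertBasis e fun n => by
      change V (π (O2.gen Letter.two) (e n)) = _
      rw [hb.map_basis, hb.map_basis, hV, hτ.apply_two]
  have hone : (V : H →L[ℂ] H) * π (O2.gen Letter.one) = π (O2.gen Letter.two) * V :=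
    ext_hilbertBasis e fun n => by
      change V (π (O2.gen Letter.one) (e n)) = π (O2.gen Letter.two) (V (e n))
      rw [hb.map_basis, hV, hV, hb.map_basis, hτ.apply_one]
  obtain ⟨ρ, rfl, hU⟩ :=
    exists_restrict_eq (Unitary.linearIsometryEquiv.symm V).2 htwo hone
  exact ⟨ρ, rfl, hb, fun n => (DFunLike.congr_fun hU (e n)).trans (hV n)⟩

theorem IsTypeP.exists_extension {I : MultiIndex} (hI : IsTypeP π I) (hπ : IsIrreducibleRep π)
    (h₁ : I ≠ MultiIndex.single Letter.one) (h₂ : I ≠ MultiIndex.single Letter.two) :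
    ∃ ρ : Q2 →⋆ₐ[ℂ] (H →L[ℂ] H), restrict ρ = π ∧ IsPermutativeQ2 ρ ∧ IsIrreducibleRep ρ ∧
      ∀ ρ' : Q2 →⋆ₐ[ℂ] (H →L[ℂ] H), restrict ρ' = π → ρ' = ρ := by
  obtain ⟨e, σ, hb, n, -, hn⟩ := hI
  have hcode (i : Letter) (m : ℕ) : codingMap hb.branching m ≠ fun _ => i := fun hm => by
    have hI := hb.eq_single_of_isTypePVector hπ hn hm
    cases i with
    | one => exact h₁ hI
    | two => exact h₂ hI
  obtain ⟨τ, hτ⟩ := hb.branching.exists_isOdometer hcode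
  obtain ⟨ρ, rfl, hρ⟩ := hτ.exists_isPermutationBasisQ2 hb
  exact ⟨ρ, rfl, hρ.isPermutativeQ2, isIrreducibleRep_of_restrict hπ,
    fun _ hρ' => eq_of_restrict_eq hb (hcode Letter.one) hρ'⟩

theorem eq_zero_of_gen_apply_eq (hb : IsPermutationBasis π e σ) {n : ℕ} {i j : Letter}
    (hcyc : IsCyclicVector π (e n)) (hn : σ i n = n) (hij : j ≠ i) {y : H}
    (hy : π (O2.gen j) y = y) : y = 0 := by
  have h := hb.branching
  have htail (m : ℕ) : h.TailEquivalent m n :=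
    Set.eq_univ_iff_forall.1 (hb.actsOnBasis.eq_univ_of_isCyclicVector hcyc
      (Y := {m | h.TailEquivalent m n}) (fun m => h.tailEquivalent_apply_iff _ m n)
      (fun m => h.tailEquivalent_apply_iff _ m n) ⟨0, 0, rfl⟩) m
  have hpred : h.pred n = n := by conv_lhs => rw [← hn, h.pred_apply]
  by_contra hy0
  obtain ⟨m, hm⟩ := hb.exists_codingMap_eq hy0 (hasCode_of_gen_apply_eq hy)
  obtain ⟨a, b, hab⟩ := htail m
  rw [Function.iterate_fixed hpred] at hab
  refine hij ?_
  calc j = codingMap h (h.pred^[a] m) 0 := by rw [h.codingMap_iterate_pred, hm]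
    _ = codingMap h (σ i n) 0 := by rw [hab, hn]
    _ = i := h.codingMap_apply_zero i n

-- `U` maps the fixed vectors of `S₁` onto those of `S₂`, because `U S₁ U* = S₂`.
theorem not_isTypeP_single (ρ : Q2 →⋆ₐ[ℂ] (H →L[ℂ] H)) (i : Letter) :
    ¬ IsTypeP (restrict ρ) (MultiIndex.single i) := by
  rintro ⟨e, σ, hb, n, hcyc, hn, -⟩
  have hfix : restrict ρ (O2.gen i) (e n) = e n := by
    simpa only [O2.word, List.map_cons, List.map_nil, List.prod_singleton] using hn
  have hσ : σ i n = n :=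
    e.orthonormal.linearIndependent.injective ((hb.map_basis i n).symm.trans hfix)
  have hU := apply_U_mem_unitary ρ
  cases i with
  | one =>
    have hzero : ρ Q2.U (e n) = 0 := eq_zero_of_gen_apply_eq hb hcyc hσ (j := Letter.two)
      (by simp) (by rw [← apply_restrict_gen_one, hfix])
    have hinv : star (ρ Q2.U) (ρ Q2.U (e n)) = e n := DFunLike.congr_fun hU.1 (e n)
    exact e.orthonormal.ne_zero n (by rw [← hinv, hzero, map_zero])
  | two =>
    have hinv (x : H) : ρ Q2.U (star (ρ Q2.U) x) = x := DFunLike.congr_fun hU.2 x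
    have hinv' (x : H) : star (ρ Q2.U) (ρ Q2.U x) = x := DFunLike.congr_fun hU.1 x
    have hzero : star (ρ Q2.U) (e n) = 0 := eq_zero_of_gen_apply_eq hb hcyc hσ (j := Letter.one)
      (by simp) (by rw [← hinv' (restrict ρ _ _), apply_restrict_gen_one, hinv, hfix])
    exact e.orthonormal.ne_zero n (by rw [← hinv (e n), hzero, map_zero])

theorem UnitarilyEquivalent.restrict (h : UnitarilyEquivalent ρ ρ') :
    UnitarilyEquivalent (restrict ρ) (restrict ρ') :=
  h.imp fun _ hV a => hV (embed a)

theorem unitarilyEquivalent_of_restrict (hρ : IsPermutativeQ2 ρ) (hirr : IsIrreducibleRep ρ)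
    (hρ' : IsPermutativeQ2 ρ') (hirr' : IsIrreducibleRep ρ')
    (h : UnitarilyEquivalent (restrict ρ) (restrict ρ')) : UnitarilyEquivalent ρ ρ' := by
  obtain ⟨e, σ, τ, hb⟩ := hρ.exists_basis
  obtain ⟨f, σ', τ', hb'⟩ := hρ'.exists_basis
  obtain ⟨V, hV⟩ := h
  by_cases hcode : ∃ n, codingMap hb.branching n = fun _ => Letter.one
  · obtain ⟨n, hn⟩ := hcode
    obtain ⟨n', hn'⟩ := hb'.exists_codingMap_eq
      (V.map_eq_zero_iff.not.2 (e.orthonormal.ne_zero n)) ((hb.hasCode n).map hV)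
    obtain ⟨m, hm⟩ := hb.exists_apply_two_eq_self hirr hn
    obtain ⟨m', hm'⟩ := hb'.exists_apply_two_eq_self hirr' (hn'.trans hn)
    obtain ⟨W, hW⟩ := hb.unitarilyEquivalent_canonicalRep hirr hm
    obtain ⟨W', hW'⟩ := hb'.unitarilyEquivalent_canonicalRep hirr' hm'
    refine ⟨W.trans W'.symm, fun a x => W'.injective ?_⟩
    simp only [LinearIsometryEquiv.trans_apply, LinearIsometryEquiv.apply_symm_apply, hW, hW']
  · exact ⟨V, fun a x => DFunLike.congr_fun (intertwines_of_intertwines_restrict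
      (B := (V : H →L[ℂ] K)) hb.toIsPermutationBasis (not_exists.1 hcode)
      (fun b => ContinuousLinearMap.ext (hV b)) a) x⟩

theorem restrict_classification (hρ : IsPermutativeQ2 ρ) (hirr : IsIrreducibleRep ρ) :
    (UnitarilyEquivalent (restrict ρ) (restrict canonicalRep) ∨
      ∃ I : MultiIndex, IsIrreducibleRep (restrict ρ) ∧ IsTypeP (restrict ρ) I) ∧
    IsMultiplicityFree (restrict ρ) := by
  obtain ⟨e, σ, τ, hb⟩ := hρ.exists_basis
  have hmf (hinj : Function.Injective (codingMap hb.branching)) : IsMultiplicityFree (restrict ρ) :=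
    ⟨⟨e, σ, hb.toIsPermutationBasis⟩, fun _ _ hb' => hb.injective_codingMap hinj hb'⟩
  by_cases hcode : ∃ n, codingMap hb.branching n = fun _ => Letter.one
  · obtain ⟨n, hn⟩ := hcode
    obtain ⟨m, hm⟩ := hb.exists_apply_two_eq_self hirr hn
    exact ⟨Or.inl (hb.unitarilyEquivalent_canonicalRep hirr hm).restrict,
      hmf (hb.injective_codingMap_of_apply_two_eq_self hirr hm)⟩
  · have hirrO := isIrreducibleRep_restrict hirr hb.toIsPermutationBasis (not_exists.1 hcode)
    obtain ⟨I, hI⟩ := hb.exists_isTypeP hirrO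
    exact ⟨Or.inr ⟨I, hirrO, hI⟩, hmf (hb.injective_codingMap_of_isIrreducibleRep hirrO)⟩

end Classification

end TwoAdic

theorem mainTheorem4 :
    -- the restriction of an irreducible permutative representation
    (∀ (H : Type u) [NormedAddCommGroup H] [InnerProductSpace ℂ H] [CompleteSpace H]
      (ρ : Q2 →⋆ₐ[ℂ] (H →L[ℂ] H)), IsPermutativeQ2 ρ → IsIrreducibleRep ρ →
        (UnitarilyEquivalent (restrict ρ) (restrict canonicalRep) ∨
          ∃ I : MultiIndex, IsIrreducibleRep (restrict ρ) ∧ IsTypeP (restrict ρ) I) ∧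
        IsMultiplicityFree (restrict ρ)) ∧
    -- the classification: the canonical representation
    (IsPermutativeQ2 canonicalRep ∧ IsIrreducibleRep canonicalRep ∧
      ¬ IsIrreducibleRep (restrict canonicalRep)) ∧
    -- the classification: extension of the irreducible representations of type `P(I)`
    (∀ (H : Type u) [NormedAddCommGroup H] [InnerProductSpace ℂ H] [CompleteSpace H]
      (π : O2 →⋆ₐ[ℂ] (H →L[ℂ] H)) (I : MultiIndex), IsIrreducibleRep π → IsTypeP π I →
        I ≠ MultiIndex.single Letter.one → I ≠ MultiIndex.single Letter.two →
        ∃ ρ : Q2 →⋆ₐ[ℂ] (H →L[ℂ] H), restrict ρ = π ∧ IsPermutativeQ2 ρ ∧ IsIrreducibleRep ρ ∧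
          ∀ ρ' : Q2 →⋆ₐ[ℂ] (H →L[ℂ] H), restrict ρ' = π → ρ' = ρ) ∧
    -- the classification: the representations of type `P(1)` and `P(2)` do not extend
    (∀ (H : Type u) [NormedAddCommGroup H] [InnerProductSpace ℂ H] [CompleteSpace H]
      (ρ : Q2 →⋆ₐ[ℂ] (H →L[ℂ] H)) (i : Letter),
        ¬ IsTypeP (restrict ρ) (MultiIndex.single i)) ∧
    -- the classification: the restriction is a complete invariant
    (∀ (H : Type u) [NormedAddCommGroup H] [InnerProductSpace ℂ H] [CompleteSpace H]
      (K : Type v) [NormedAddCommGroup K] [InnerProductSpace ℂ K] [CompleteSpace K]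
      (ρ : Q2 →⋆ₐ[ℂ] (H →L[ℂ] H)) (ρ' : Q2 →⋆ₐ[ℂ] (K →L[ℂ] K)),
        IsPermutativeQ2 ρ → IsIrreducibleRep ρ → IsPermutativeQ2 ρ' → IsIrreducibleRep ρ' →
        (UnitarilyEquivalent ρ ρ' ↔ UnitarilyEquivalent (restrict ρ) (restrict ρ'))) :=
  ⟨fun _ _ _ _ _ hρ hirr => restrict_classification hρ hirr,
    ⟨isPermutativeQ2_canonicalRep, isIrreducibleRep_canonicalRep,
      not_isIrreducibleRep_restrict_canonicalRep⟩,
    fun _ _ _ _ _ _ hπ hI h₁ h₂ => hI.exists_extension hπ h₁ h₂,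
    fun _ _ _ _ ρ i => not_isTypeP_single ρ i,
    fun _ _ _ _ _ _ _ _ _ _ hρ hirr hρ' hirr' =>
      ⟨UnitarilyEquivalent.restrict, unitarilyEquivalent_of_restrict hρ hirr hρ' hirr'⟩⟩
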